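/- All matrices are complex $2\times 2$ matrices. Let $s_{j,1},s_{j,2}$ ($j=1,\dots,4$) be complex numbers with $\prod_{j=1}^4 s_{j,1}s_{j,2}=1$ which are generic, i.e. $s_{1,k_1}s_{2,k_2}s_{3,k_3}s_{4,k_4}\neq 1$ for every choice of indices $k_1,\dots,k_4\in\{1,2\}$. Sets of quadruples of matrices are regarded as subsets of the affine space $\mathbb{C}^{16}$ with its Zariski topology. (They are locally closed, and are considered as reduced quasi-affine varieties; such a variety is smooth if all its local rings at its points are regular, and an irreducible variety is in particular non-empty.) 1) Suppose that $s_{j,1}\neq s_{j,2}$ for $j=1,2,3$ and $s_{4,1}=s_{4,2}=-1$. Let $\mathcal N$ be the set of quadruples $(N_1,N_2,N_3,N_4)$ such that $N_1N_2N_3N_4=I$, $N_j$ is conjugate to $\mathrm{diag}(s_{j,1},s_{j,2})$ for $j=1,2,3$, and $N_4=-I$. Let $\mathcal P$ be the set of quadruples $(P_1,P_2,P_3,P_4)$ such that $P_1P_2P_3P_4=I$, $P_j$ is conjugate to $\mathrm{diag}(s_{j,1},s_{j,2})$ for $j=1,2,3$, and $P_4$ is conjugate to the Jordan block $\begin{pmatrix}-1&1\\0&-1\end{pmatrix}$.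 Then all quadruples in $\mathcal N$ and in $\mathcal P$ are irreducible (the four matrices have no common invariant line), $\mathcal N$ is a smooth irreducible variety of dimension $3$, and $\mathcal P$ is a smooth irreducible variety of dimension $5$. 2) Suppose that $s_{j,1}\neq s_{j,2}$ for $j=1,2,3,4$. Then the set of quadruples $(M_1,M_2,M_3,M_4)$ such that $M_1M_2M_3M_4=I$ and each $M_j$ is conjugate to $\mathrm{diag}(s_{j,1},s_{j,2})$ is a smooth irreducible variety of dimension $5$. -/

import Mathlib

open MvPolynomial

noncomputable section

/-! ### Quasi-affine varieties over `ℂ`, classically: subsets of an affine space `ℂ^σ` -/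

namespace Variety

variable {σ : Type*}

/-- The Zariski topology on the affine space `ℂ^σ` (on `ℂ`-points), induced from the prime
spectrum of the polynomial ring. See `isClosed_zariski_iff`. -/
abbrev zariski (σ : Type*) : TopologicalSpace (σ → ℂ) :=
  TopologicalSpace.induced (pointToPoint (k := ℂ)) PrimeSpectrum.zariskiTopology

/-- The Zariski closed subsets of `ℂ^σ` are the common zero sets of ideals of polynomials. -/
theorem isClosed_zariski_iff (Z : Set (σ → ℂ)) :
    @IsClosed _ (zariski σ) Z ↔ ∃ I : Ideal (MvPolynomial σ ℂ), Z = zeroLocus ℂ I := by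
  have key : ∀ I : Ideal (MvPolynomial σ ℂ),
      pointToPoint (k := ℂ) ⁻¹' PrimeSpectrum.zeroLocus (I : Set (MvPolynomial σ ℂ)) =
        zeroLocus ℂ I := by
    intro I
    ext x
    simp only [Set.mem_preimage, PrimeSpectrum.mem_zeroLocus, pointToPoint]
    constructor
    · intro h p hp
      exact (mem_vanishingIdeal_singleton_iff x p).1 (h hp)
    · intro h p hp
      exact (mem_vanishingIdeal_singleton_iff x p).2 (h p hp)
  rw [zariski, isClosed_induced_iff]
  constructor
  · rintro ⟨t, ht, rfl⟩
    obtain ⟨I, rfl⟩ := (PrimeSpectrum.isClosed_iff_zeroLocus_ideal t).1 ht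
    exact ⟨I, key I⟩
  · rintro ⟨I, rfl⟩
    exact ⟨_, PrimeSpectrum.isClosed_zeroLocus _, key I⟩

/-- The dimension of `V ⊆ ℂ^σ`: the Krull dimension of `V` with its Zariski topology. -/
def dim (V : Set (σ → ℂ)) : WithBot ℕ∞ :=
  @topologicalKrullDim V (@instTopologicalSpaceSubtype _ (· ∈ V) (zariski σ))

/-- The local ring of (the reduced variety) `V` at a point `x ∈ V`: the local ring of the affine
space at `x`, modulo the polynomials that vanish on `V`. -/
abbrev LocalRing (V : Set (σ → ℂ)) (x : σ → ℂ) : Type _ :=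
  Localization.AtPrime (vanishingIdeal ℂ {x} : Ideal (MvPolynomial σ ℂ)) ⧸
    (vanishingIdeal ℂ V).map
      (algebraMap (MvPolynomial σ ℂ)
        (Localization.AtPrime (vanishingIdeal ℂ {x} : Ideal (MvPolynomial σ ℂ))))

/-- `V` is a quasi-affine variety (locally closed) all of whose local rings are regular. -/
structure IsSmooth (V : Set (σ → ℂ)) : Prop where
  locallyClosed : @IsLocallyClosed _ (zariski σ) V
  regular : ∀ x ∈ V, IsRegularLocalRing (LocalRing V x)

/-- `V` is a smooth irreducible (in particular non-empty) quasi-affine variety of dimension `d`. -/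
structure IsSmoothIrreducibleOfDim (V : Set (σ → ℂ)) (d : ℕ) : Prop where
  smooth : IsSmooth V
  irreducible : @IsIrreducible _ (zariski σ) V
  dim_eq : dim V = d

end Variety

/-! ### Quadruples of `2 × 2` matrices -/

/-- Quadruples of complex `2 × 2` matrices. -/
abbrev Quadruple : Type := Fin 4 → Matrix (Fin 2) (Fin 2) ℂ

/-- The sixteen entries of a quadruple, as a point of affine space. -/
def Quadruple.coords (M : Quadruple) : Fin 4 × Fin 2 × Fin 2 → ℂ :=
  fun i => M i.1 i.2.1 i.2.2

/-- The quadruples `(M₁, M₂, M₃, M₄)` with `M₁ M₂ M₃ M₄ = I` such that each `M_j` lies in the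
conjugacy class of a given matrix `A_j`. -/
def quadruples (A : Quadruple) : Set Quadruple :=
  {M | (∀ j, IsConj (A j) (M j)) ∧ M 0 * M 1 * M 2 * M 3 = 1}

/-- The matrices of the tuple have no common invariant subspace other than `0` and `ℂ²`. -/
def Quadruple.IsIrreducible (M : Quadruple) : Prop :=
  ∀ W : Submodule ℂ (Fin 2 → ℂ),
    (∀ j, ∀ v ∈ W, (M j).mulVec v ∈ W) → W = ⊥ ∨ W = ⊤

/-- Eigenvalues `s j k` (the `k`-th eigenvalue of the `j`-th `n × n` matrix, repeated according to
multiplicity) are generic if they satisfy no non-genericity relation, that is, no relation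
`∏ j, ∏ k ∈ Φ j, s j k = 1` with sets `Φ j` all of one and the same cardinality `m`, `0 < m < n`. -/
def IsGeneric {ι : Type*} [Fintype ι] {n : ℕ} (s : ι → Fin n → ℂ) : Prop :=
  ∀ (m : ℕ) (Φ : ι → Finset (Fin n)), 0 < m → m < n → (∀ j, (Φ j).card = m) →
    ∏ j, ∏ k ∈ Φ j, s j k ≠ 1

/-- All four matrices diagonal, with eigenvalues `s j 0`, `s j 1`. -/
def diagRep (s : Fin 4 → Fin 2 → ℂ) : Quadruple :=
  fun j => Matrix.diagonal (s j)

/-- The first three matrices diagonal, with eigenvalues `s j 0`, `s j 1`; the last one is the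
Jordan block of size `2` with eigenvalue `-1`. -/
def jordanRep (s : Fin 4 → Fin 2 → ℂ) : Quadruple :=
  fun j => if j = 3 then !![-1, 1; 0, -1] else Matrix.diagonal (s j)

end

namespace Variety

attribute [local instance] Variety.zariski

variable {σ τ υ : Type*}

/-! ### The Zariski topology -/

/-! Smoothness, irreducibility and dimension all come from charts. Suppose a locally closed `V` is
covered by open pieces that are isomorphic, by regular maps in both directions, to open subsets of
`ℂ^d`, and suppose any two pieces meet. Then `V` is irreducible, its local rings are local rings of
`ℂ^d`, hence regular, and its dimension is `d` (`Variety.isSmoothIrreducibleOfDim_of_charts`).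

The conjugacy classes involved are given by trace and determinant, except that the fourth matrix may
also be required to be, or not to be, `-1`. This leaves two loci, `scalarLocus` and
`nonscalarLocus`; the latter serves both the Jordan case and part 2.

A matrix of given trace and determinant with nonzero upper right entry is determined by its first
row, so `M 0` and `M 1` give four free parameters. Put `B = M 0 * M 1` and `X = M 2`. Since `M 3` is
the inverse of `B * X`, it remains to give `X` eigenvalues `a`, `b` and to prescribe the trace of `B
* X`. Once the slope `y` of the `b`-eigenvector `u = (1, y)` is fixed, this is a linear equation for
one entry of `X`, with leading coefficient `det (u, B u)`. It is uniquely solvable if `u` is not an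
eigenvector of `B`. The slope is the fifth parameter. If `M 3 = -1`, the same construction with `B =
M 0` and `X = M 1` gives three parameters.

The eigenvector condition is conjugation invariant: it says `(X - b) * B * (X - a) ≠ 0`. The
remaining conditions, that certain entries do not vanish, hold after conjugation by all but finitely
many unipotent matrices (`finite_conj_apply_eq_zero`). In the scalar locus a failure of the
eigenvector condition would give a common eigenvector, which genericity forbids. In the nonscalar
locus, failure for both eigenvalues of `M 2` and, after reversing the quadruple, for both
eigenvalues of `M 0` makes these matrices commute with the nonscalar `M 3`, and again a common
eigenvector appears (`exists_sandwich_ne_zero`). The charts meet because one explicit quadruple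
satisfies the condition for all of them, and a generic conjugate of it lies in any two given charts.
-/

theorem isClosed_zeros (P : MvPolynomial σ ℂ) : IsClosed {z : σ → ℂ | eval z P = 0} := by
  rw [isClosed_zariski_iff]
  refine ⟨Ideal.span {P}, ?_⟩
  rw [zeroLocus_span]
  ext z
  simp [aeval_eq_eval]

theorem isOpen_nonzeros (P : MvPolynomial σ ℂ) : IsOpen {z : σ → ℂ | eval z P ≠ 0} :=
  (isClosed_zeros P).isOpen_compl

theorem exists_basicOpen_subset {O : Set (σ → ℂ)} (hO : IsOpen O) {x : σ → ℂ} (hx : x ∈ O) :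
    ∃ P : MvPolynomial σ ℂ, eval x P ≠ 0 ∧ ∀ z, eval z P ≠ 0 → z ∈ O := by
  obtain ⟨I, hI⟩ := (isClosed_zariski_iff _).1 hO.isClosed_compl
  have hx' : x ∉ zeroLocus ℂ I := by rw [← hI]; exact fun h => h hx
  simp only [mem_zeroLocus_iff, not_forall] at hx'
  obtain ⟨P, hP, hPx⟩ := hx'
  refine ⟨P, by simpa [aeval_eq_eval] using hPx, fun z hz => ?_⟩
  by_contra hzO
  have : z ∈ zeroLocus ℂ I := by rw [← hI]; exact hzO
  exact hz (by simpa [aeval_eq_eval] using this P hP)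

/-- Over an infinite field a nonzero polynomial has a nonzero value; applied to `P * Q`, this makes
any two nonempty basic open sets meet. -/
theorem isIrreducible_univ : IsIrreducible (Set.univ : Set (σ → ℂ)) := by
  refine ⟨⟨0, trivial⟩, ?_⟩
  rintro U W hU hW ⟨x, -, hx⟩ ⟨y, -, hy⟩
  obtain ⟨P, hPx, hP⟩ := exists_basicOpen_subset hU hx
  obtain ⟨Q, hQy, hQ⟩ := exists_basicOpen_subset hW hy
  have hPQ : P * Q ≠ 0 := by
    refine mul_ne_zero ?_ ?_
    · rintro rfl; simp at hPx
    · rintro rfl; simp at hQy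
  obtain ⟨z, hz⟩ : ∃ z, eval z (P * Q) ≠ 0 := by
    by_contra! h
    exact hPQ (MvPolynomial.funext fun z => by simpa using h z)
  rw [map_mul, mul_ne_zero_iff] at hz
  exact ⟨z, trivial, hP z hz.1, hQ z hz.2⟩

/-- A polynomial that vanishes on a non-empty open set is zero. -/
theorem eq_zero_of_eval_eq_zero {O : Set (σ → ℂ)} (hO : IsOpen O) (hne : O.Nonempty)
    {P : MvPolynomial σ ℂ} (h : ∀ z ∈ O, eval z P = 0) : P = 0 := by
  refine MvPolynomial.funext fun z => ?_
  by_contra hz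
  obtain ⟨w, -, hwO, hw⟩ := isIrreducible_univ.2 O _ hO (isOpen_nonzeros P)
    (by simpa using hne) ⟨z, trivial, by simpa using hz⟩
  exact hw (h w hwO)

/-! ### Regular functions -/

/-- The function `f` is given on `S` by a quotient of polynomials whose denominator has no zero
on `S`. -/
def IsRegularOn (S : Set (σ → ℂ)) (f : (σ → ℂ) → ℂ) : Prop :=
  ∃ P Q : MvPolynomial σ ℂ, ∀ y ∈ S, eval y Q ≠ 0 ∧ f y = eval y P / eval y Q

namespace IsRegularOn

variable {S T : Set (σ → ℂ)} {f g : (σ → ℂ) → ℂ}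

theorem mono (h : IsRegularOn T f) (hST : S ⊆ T) : IsRegularOn S f := by
  obtain ⟨P, Q, hPQ⟩ := h
  exact ⟨P, Q, fun y hy => hPQ y (hST hy)⟩

theorem congr (h : IsRegularOn S f) (hfg : ∀ y ∈ S, g y = f y) : IsRegularOn S g := by
  obtain ⟨P, Q, hPQ⟩ := h
  exact ⟨P, Q, fun y hy => ⟨(hPQ y hy).1, (hfg y hy).trans (hPQ y hy).2⟩⟩

theorem const (c : ℂ) : IsRegularOn S (fun _ => c) :=
  ⟨C c, 1, fun y _ => by simp⟩

theorem coord (i : σ) : IsRegularOn S (fun y => y i) :=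
  ⟨X i, 1, fun y _ => by simp⟩

theorem add (hf : IsRegularOn S f) (hg : IsRegularOn S g) : IsRegularOn S (fun y => f y + g y) := by
  obtain ⟨P, Q, h⟩ := hf
  obtain ⟨P', Q', h'⟩ := hg
  refine ⟨P * Q' + P' * Q, Q * Q', fun y hy => ?_⟩
  obtain ⟨h1, h2⟩ := h y hy
  obtain ⟨h3, h4⟩ := h' y hy
  refine ⟨by simp [h1, h3], ?_⟩
  beta_reduce
  rw [h2, h4]
  simp only [map_add, map_mul]
  field_simp

theorem mul (hf : IsRegularOn S f) (hg : IsRegularOn S g) : IsRegularOn S (fun y => f y * g y) := by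
  obtain ⟨P, Q, h⟩ := hf
  obtain ⟨P', Q', h'⟩ := hg
  refine ⟨P * P', Q * Q', fun y hy => ?_⟩
  obtain ⟨h1, h2⟩ := h y hy
  obtain ⟨h3, h4⟩ := h' y hy
  refine ⟨by simp [h1, h3], ?_⟩
  beta_reduce
  rw [h2, h4]
  simp only [map_mul]
  field_simp

theorem inv (hf : IsRegularOn S f) (h0 : ∀ y ∈ S, f y ≠ 0) : IsRegularOn S (fun y => (f y)⁻¹) := by
  obtain ⟨P, Q, h⟩ := hf
  refine ⟨Q, P, fun y hy => ?_⟩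
  obtain ⟨h1, h2⟩ := h y hy
  have := h0 y hy
  beta_reduce
  rw [h2] at this ⊢
  exact ⟨fun h => this (by simp [h]), by simp⟩

theorem div (hf : IsRegularOn S f) (hg : IsRegularOn S g) (h0 : ∀ y ∈ S, g y ≠ 0) :
    IsRegularOn S (fun y => f y / g y) := by
  simp only [div_eq_mul_inv]
  exact hf.mul (hg.inv h0)

theorem neg (hf : IsRegularOn S f) : IsRegularOn S (fun y => -f y) :=
  ((const (-1)).mul hf).congr fun y _ => by simp

theorem sub (hf : IsRegularOn S f) (hg : IsRegularOn S g) : IsRegularOn S (fun y => f y - g y) :=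
  (hf.add hg.neg).congr fun _ _ => sub_eq_add_neg _ _

theorem eval_comp {φ : (σ → ℂ) → τ → ℂ} (hφ : ∀ i, IsRegularOn S (fun y => φ y i))
    (P : MvPolynomial τ ℂ) : IsRegularOn S (fun y => eval (φ y) P) := by
  induction P using MvPolynomial.induction_on with
  | C a => simpa using const a
  | add p q hp hq => simpa using hp.add hq
  | mul_X p i hp => simpa using hp.mul (hφ i)

theorem comp {φ : (σ → ℂ) → τ → ℂ} {T : Set (τ → ℂ)} {f : (τ → ℂ) → ℂ} (hf : IsRegularOn T f)
    (hφ : ∀ i, IsRegularOn S (fun y => φ y i)) (hST : Set.MapsTo φ S T) :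
    IsRegularOn S (fun y => f (φ y)) := by
  obtain ⟨P, Q, h⟩ := hf
  exact ((eval_comp hφ P).div (eval_comp hφ Q) fun _ hy => (h _ (hST hy)).1).congr
    fun _ hy => (h _ (hST hy)).2

theorem isOpen_ne (hf : IsRegularOn S f) (hS : IsOpen S) : IsOpen {y | y ∈ S ∧ f y ≠ 0} := by
  obtain ⟨P, Q, h⟩ := hf
  have : {y | y ∈ S ∧ f y ≠ 0} = S ∩ {y | eval y P ≠ 0} := by
    ext y
    simp only [Set.mem_ofPred_eq, Set.mem_inter_iff, and_congr_right_iff]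
    intro hy
    obtain ⟨h1, h2⟩ := h y hy
    rw [h2]
    simp [h1]
  rw [this]
  exact hS.inter (isOpen_nonzeros P)

/-- A polynomial composed with `φ` is a quotient whose zeros on `S` are those of its numerator, so
zero loci pull back to relatively closed sets. -/
theorem continuousOn {φ : (σ → ℂ) → τ → ℂ} (hφ : ∀ i, IsRegularOn S (fun y => φ y i)) :
    ContinuousOn φ S := by
  rw [continuousOn_iff_isClosed]
  intro t ht
  obtain ⟨I, rfl⟩ := (isClosed_zariski_iff t).1 ht
  choose P Q h using fun p : MvPolynomial τ ℂ => eval_comp hφ p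
  refine ⟨⋂ p ∈ I, {y | eval y (P p) = 0},
    isClosed_iInter fun p => isClosed_iInter fun _ => isClosed_zeros _, ?_⟩
  ext y
  simp only [Set.mem_inter_iff, Set.mem_preimage, mem_zeroLocus_iff, Set.mem_iInter,
    Set.mem_ofPred_eq, and_congr_left_iff]
  intro hy
  refine forall₂_congr fun p _ => ?_
  obtain ⟨h1, h2⟩ := h p y hy
  beta_reduce at h2
  rw [aeval_eq_eval, h2]
  simp [h1]

end IsRegularOn

/-! ### Dimension -/

/-- A chain of irreducible closed sets can be restricted to a neighbourhood of a point of its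
smallest member: each member meets that neighbourhood, and no inclusion collapses. -/
theorem _root_.topologicalKrullDim_le_of_isOpen_cover {X : Type*} [TopologicalSpace X]
    {d : WithBot ℕ∞}
    (h : ∀ x : X, ∃ U : Set X, IsOpen U ∧ x ∈ U ∧ topologicalKrullDim U ≤ d) :
    topologicalKrullDim X ≤ d := by
  refine iSup_le fun p => ?_
  obtain ⟨x, hx⟩ := p.head.isIrreducible.1
  obtain ⟨U, hU, hxU, hd⟩ := h x
  refine le_trans ?_ hd
  have hmem : ∀ i, x ∈ (p i : Set X) := fun i => (p.head_le i) hx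
  let q : LTSeries (TopologicalSpace.IrreducibleCloseds U) :=
    { length := p.length
      toFun := fun i => ⟨Subtype.val ⁻¹' (p i : Set X),
        (p i).isIrreducible.preimage hU.isOpenEmbedding_subtypeVal ⟨x, hmem i, by simpa using hxU⟩,
        (p i).isClosed.preimage continuous_subtype_val⟩
      step := fun i => by
        have hlt : p i.castSucc < p i.succ := p.step i
        change (_ : TopologicalSpace.IrreducibleCloseds U) < _
        refine lt_of_le_not_ge (fun z hz => hlt.le hz) fun hle => hlt.not_ge fun z hz => ?_
        -- An irreducible closed set is the closure of its nonempty open part in `U`, so equal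
        -- traces on `U` would force equal members.
        have hcl : closure ((p i.succ : Set X) ∩ U) ⊆ p i.castSucc := by
          refine closure_minimal ?_ (p i.castSucc).isClosed
          rintro w ⟨hw, hwU⟩
          exact @hle ⟨w, hwU⟩ hw
        exact hcl (subset_closure_inter_of_isPreirreducible_of_isOpen
          (p i.succ).isIrreducible.2 hU ⟨x, hmem _, hxU⟩ hz) }
  exact le_iSup (fun q : LTSeries (TopologicalSpace.IrreducibleCloseds U) =>
    ((q.length : ℕ∞) : WithBot ℕ∞)) q

theorem topologicalKrullDim_affineSpace_le [Finite τ] :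
    topologicalKrullDim (τ → ℂ) ≤ Nat.card τ := by
  have h : Topology.IsInducing (pointToPoint (k := ℂ) : (τ → ℂ) → _) := ⟨rfl⟩
  refine h.topologicalKrullDim_le.trans ?_
  rw [PrimeSpectrum.topologicalKrullDim_eq_ringKrullDim,
    MvPolynomial.ringKrullDim_of_isNoetherianRing, ringKrullDim_eq_zero_of_field, zero_add]

/-- The chain is the trace on `D` of a flag of affine subspaces through a point `y` of `D`; `Z i`
leaves only the first `i` coordinates free. -/
theorem le_topologicalKrullDim_of_isOpen {d : ℕ} {D : Set (Fin d → ℂ)} (hD : IsOpen D)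
    (hne : D.Nonempty) : (d : WithBot ℕ∞) ≤ topologicalKrullDim D := by
  obtain ⟨y, hy⟩ := hne
  let Z : ℕ → Set (Fin d → ℂ) := fun i => {z | ∀ j : Fin d, i ≤ j → z j = y j}
  have hyZ : ∀ i, y ∈ Z i := fun i j _ => rfl
  have hZcl : ∀ i, IsClosed (Z i) := fun i => by
    have : Z i = ⋂ j : Fin d, ⋂ _ : i ≤ j, {z | eval z (X j - C (y j)) = 0} := by
      ext z; simp [Z, sub_eq_zero]
    rw [this]
    exact isClosed_iInter fun j => isClosed_iInter fun _ => isClosed_zeros _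
  have hZirr : ∀ i, IsIrreducible (Z i) := fun i => by
    -- `Z i` is the image of the irreducible affine space under the projection that resets the later
    -- coordinates to those of `y`.
    let φ : (Fin d → ℂ) → Fin d → ℂ := fun z j => if i ≤ j then y j else z j
    have hφ : φ '' Set.univ = Z i := by
      ext z
      constructor
      · rintro ⟨w, -, rfl⟩ j hj
        simp [φ, hj]
      · intro hz
        refine ⟨z, trivial, funext fun j => ?_⟩
        by_cases hj : i ≤ j
        · simp [φ, hj, hz j hj]
        · simp [φ, hj]
    rw [← hφ]
    refine isIrreducible_univ.image φ (IsRegularOn.continuousOn fun j => ?_)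
    by_cases hj : i ≤ j
    · simpa [φ, hj] using IsRegularOn.const _
    · simpa [φ, hj] using IsRegularOn.coord _
  let q : LTSeries (TopologicalSpace.IrreducibleCloseds D) :=
    { length := d
      toFun := fun i => ⟨Subtype.val ⁻¹' Z i,
        (hZirr i).preimage hD.isOpenEmbedding_subtypeVal ⟨y, hyZ i, by simpa using hy⟩,
        (hZcl i).preimage continuous_subtype_val⟩
      step := fun i => by
        change (_ : TopologicalSpace.IrreducibleCloseds D) < _
        refine lt_of_le_not_ge (fun z hz j hj => hz j (le_trans (by simp) hj)) fun hle => ?_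
        -- Strictness: the irreducible set `Z (i + 1)` meets `D` at `y`, and meets the open set
        -- where the `i`-th coordinate differs from `y i` at a shift of `y`. Hence it meets both at
        -- once, outside `Z i`.
        obtain ⟨w, hw, hwD, hwi⟩ := (hZirr i.succ).2 D _ hD (isOpen_nonzeros (X i - C (y i)))
          ⟨y, hyZ _, hy⟩ ⟨Function.update y i (y i + 1), fun j hj => by
            rw [Function.update_of_ne]
            rintro rfl
            simp at hj, by simp⟩
        refine hwi ?_
        have := @hle ⟨w, hwD⟩ hw i le_rfl
        simp only at this
        simp [this] }
  exact le_iSup (fun q : LTSeries (TopologicalSpace.IrreducibleCloseds D) =>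
    ((q.length : ℕ∞) : WithBot ℕ∞)) q

end Variety

namespace Variety

attribute [local instance] Variety.zariski

variable {σ τ υ : Type*}

/-! ### Charts -/

/-- A chart of `V ⊆ ℂ^σ`: mutually inverse regular maps between an open subset of `ℂ^d` and the
intersection of `V` with an open subset of `ℂ^σ`. -/
structure Chart (V : Set (σ → ℂ)) (d : ℕ) where
  dom : Set (Fin d → ℂ)
  nbhd : Set (σ → ℂ)
  param : (Fin d → ℂ) → σ → ℂ
  coord : (σ → ℂ) → Fin d → ℂ
  isOpen_dom : IsOpen dom
  isOpen_nbhd : IsOpen nbhd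
  regular_param : ∀ i, IsRegularOn dom (fun y => param y i)
  regular_coord : ∀ k, IsRegularOn (V ∩ nbhd) (fun z => coord z k)
  mapsTo_param : Set.MapsTo param dom (V ∩ nbhd)
  mapsTo_coord : Set.MapsTo coord (V ∩ nbhd) dom
  coord_param : ∀ y ∈ dom, coord (param y) = y
  param_coord : ∀ z ∈ V ∩ nbhd, param (coord z) = z

namespace Chart

variable {V : Set (σ → ℂ)} {d : ℕ} (c : Chart V d)

theorem image_param : c.param '' c.dom = V ∩ c.nbhd :=
  Set.Subset.antisymm (c.mapsTo_param.image_subset)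
    fun z hz => ⟨c.coord z, c.mapsTo_coord hz, c.param_coord z hz⟩

/-- Transport of a chart along a regular isomorphism of varieties. -/
def map {W : Set (υ → ℂ)} (α : (σ → ℂ) → υ → ℂ) (β : (υ → ℂ) → σ → ℂ)
    (hα : ∀ i, IsRegularOn Set.univ (fun z => α z i))
    (hβ : ∀ i, IsRegularOn Set.univ (fun z => β z i))
    (hαV : Set.MapsTo α V W) (hβW : Set.MapsTo β W V)
    (hβα : ∀ z ∈ V, β (α z) = z) (hαβ : ∀ w ∈ W, α (β w) = w) : Chart W d where
  dom := c.dom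
  nbhd := β ⁻¹' c.nbhd
  param y := α (c.param y)
  coord w := c.coord (β w)
  isOpen_dom := c.isOpen_dom
  isOpen_nbhd := c.isOpen_nbhd.preimage
    (continuousOn_univ.1 (IsRegularOn.continuousOn hβ))
  regular_param i := (hα i).comp c.regular_param fun _ _ => trivial
  regular_coord k := (c.regular_coord k).comp (fun i => (hβ i).mono (Set.subset_univ _))
    fun _ hw => ⟨hβW hw.1, hw.2⟩
  mapsTo_param y hy := by
    have h := c.mapsTo_param hy
    refine ⟨hαV h.1, ?_⟩
    rw [Set.mem_preimage, hβα _ h.1]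
    exact h.2
  mapsTo_coord w hw := c.mapsTo_coord ⟨hβW hw.1, hw.2⟩
  coord_param y hy := by
    rw [hβα _ (c.mapsTo_param hy).1, c.coord_param y hy]
  param_coord w hw := by
    rw [c.param_coord _ ⟨hβW hw.1, hw.2⟩, hαβ _ hw.1]

theorem isPreirreducible : IsPreirreducible (V ∩ c.nbhd) := by
  rw [← c.image_param]
  exact (isIrreducible_univ.2.open_subset c.isOpen_dom (Set.subset_univ _)).image _
    (IsRegularOn.continuousOn c.regular_param)

/-- A chart is a homeomorphism. -/
def homeomorph : ↥(V ∩ c.nbhd) ≃ₜ c.dom where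
  toFun z := ⟨c.coord z, c.mapsTo_coord z.2⟩
  invFun y := ⟨c.param y, c.mapsTo_param y.2⟩
  left_inv z := Subtype.ext (c.param_coord _ z.2)
  right_inv y := Subtype.ext (c.coord_param _ y.2)
  continuous_toFun := (continuousOn_iff_continuous_domRestrict.1
    (IsRegularOn.continuousOn c.regular_coord)).subtype_mk _
  continuous_invFun := (continuousOn_iff_continuous_domRestrict.1
    (IsRegularOn.continuousOn c.regular_param)).subtype_mk _

theorem topologicalKrullDim_le : topologicalKrullDim ↥(V ∩ c.nbhd) ≤ d := by
  refine (Topology.IsInducing.subtypeVal.comp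
    c.homeomorph.isInducing).topologicalKrullDim_le.trans ?_
  simpa using topologicalKrullDim_affineSpace_le (τ := Fin d)

theorem le_topologicalKrullDim (hne : (V ∩ c.nbhd).Nonempty) :
    (d : WithBot ℕ∞) ≤ topologicalKrullDim V := by
  obtain ⟨z, hz⟩ := hne
  refine (le_topologicalKrullDim_of_isOpen c.isOpen_dom ⟨_, c.mapsTo_coord hz⟩).trans
    (le_trans c.homeomorph.symm.isInducing.topologicalKrullDim_le ?_)
  exact ((Topology.IsInducing.of_comp_iff (f := Set.inclusion Set.inter_subset_left)
    Topology.IsInducing.subtypeVal).1 Topology.IsInducing.subtypeVal).topologicalKrullDim_le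

end Chart

/-! ### Germs -/

/-- The germ `α` at `y` is represented, on the open set `D`, by the function `f`. -/
def IsGermOf (D : Set (τ → ℂ)) {y : τ → ℂ}
    (α : Localization.AtPrime (vanishingIdeal ℂ {y} : Ideal (MvPolynomial τ ℂ)))
    (f : (τ → ℂ) → ℂ) : Prop :=
  ∃ a b : MvPolynomial τ ℂ, eval y b ≠ 0 ∧ α * algebraMap _ _ b = algebraMap _ _ a ∧
    ∀ w ∈ D, f w * eval w b = eval w a

theorem isUnit_algebraMap_of_eval_ne_zero {y : τ → ℂ} {b : MvPolynomial τ ℂ} (hb : eval y b ≠ 0) :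
    IsUnit (algebraMap _
      (Localization.AtPrime (vanishingIdeal ℂ {y} : Ideal (MvPolynomial τ ℂ))) b) :=
  IsLocalization.map_units _ (⟨b, fun h => hb (by
    simpa [aeval_eq_eval] using (mem_vanishingIdeal_singleton_iff y b).1 h)⟩ :
      (vanishingIdeal ℂ {y} : Ideal (MvPolynomial τ ℂ)).primeCompl)

theorem eval_ne_zero_of_mem_primeCompl {y : τ → ℂ}
    (b : (vanishingIdeal ℂ {y} : Ideal (MvPolynomial τ ℂ)).primeCompl) :
    eval y (b : MvPolynomial τ ℂ) ≠ 0 := fun h =>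
  b.2 ((mem_vanishingIdeal_singleton_iff y _).2 (by simpa [aeval_eq_eval] using h))

theorem algebraMap_atPrime_injective (y : τ → ℂ) : Function.Injective (algebraMap
    (MvPolynomial τ ℂ)
    (Localization.AtPrime (vanishingIdeal ℂ {y} : Ideal (MvPolynomial τ ℂ)))) :=
  IsLocalization.injective _ (Ideal.primeCompl_le_nonZeroDivisors
    (vanishingIdeal ℂ {y} : Ideal (MvPolynomial τ ℂ)))

namespace IsGermOf

variable {D : Set (τ → ℂ)} {y : τ → ℂ}
  {α β : Localization.AtPrime (vanishingIdeal ℂ {y} : Ideal (MvPolynomial τ ℂ))}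
  {f g : (τ → ℂ) → ℂ}

theorem of_eval (P : MvPolynomial τ ℂ) : IsGermOf D (y := y) (algebraMap _ _ P)
    (fun w => eval w P) :=
  ⟨P, 1, by simp, by simp, by simp⟩

theorem add (hf : IsGermOf D α f) (hg : IsGermOf D β g) :
    IsGermOf D (α + β) (fun w => f w + g w) := by
  obtain ⟨a, b, h1, h2, h3⟩ := hf
  obtain ⟨a', b', h1', h2', h3'⟩ := hg
  refine ⟨a * b' + a' * b, b * b', by simp [h1, h1'], ?_, fun w hw => ?_⟩
  · simp only [map_add, map_mul, ← h2, ← h2']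
    ring
  · simp only [map_add, map_mul, ← h3 w hw, ← h3' w hw]
    ring

theorem mul (hf : IsGermOf D α f) (hg : IsGermOf D β g) :
    IsGermOf D (α * β) (fun w => f w * g w) := by
  obtain ⟨a, b, h1, h2, h3⟩ := hf
  obtain ⟨a', b', h1', h2', h3'⟩ := hg
  refine ⟨a * a', b * b', by simp [h1, h1'], ?_, fun w hw => ?_⟩
  · simp only [map_mul, ← h2, ← h2']
    ring
  · simp only [map_mul, ← h3 w hw, ← h3' w hw]
    ring

/-- Cross-multiplied representatives agree on a nonempty open set, hence as polynomials. The point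
`y` need not lie in `D`, and the denominators may vanish on parts of `D`. -/
theorem unique (hD : IsOpen D) (hne : D.Nonempty) (hf : IsGermOf D α f) (hg : IsGermOf D β g)
    (hfg : ∀ w ∈ D, f w = g w) : α = β := by
  obtain ⟨a, b, h1, h2, h3⟩ := hf
  obtain ⟨a', b', h1', h2', h3'⟩ := hg
  have h : a * b' - a' * b = 0 := eq_zero_of_eval_eq_zero hD hne fun w hw => by
    simp only [map_sub, map_mul, ← h3 w hw, ← h3' w hw, hfg w hw]
    ring
  have h' := congrArg (algebraMap _
    (Localization.AtPrime (vanishingIdeal ℂ {y} : Ideal (MvPolynomial τ ℂ)))) h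
  simp only [map_sub, map_mul, ← h2, ← h2', map_zero] at h'
  refine ((isUnit_algebraMap_of_eval_ne_zero h1).mul
    (isUnit_algebraMap_of_eval_ne_zero h1')).mul_left_injective ?_
  linear_combination h'

theorem exists_of_isRegularOn (hf : IsRegularOn D f) (hy : y ∈ D) :
    ∃ α : Localization.AtPrime (vanishingIdeal ℂ {y} : Ideal (MvPolynomial τ ℂ)),
      IsGermOf D α f := by
  obtain ⟨P, Q, h⟩ := hf
  obtain ⟨u, hu⟩ := isUnit_algebraMap_of_eval_ne_zero (h y hy).1
  refine ⟨algebraMap _ _ P * ↑u⁻¹, P, Q, (h y hy).1, ?_, fun w hw => ?_⟩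
  · rw [← hu, mul_assoc, Units.inv_mul, mul_one]
  · rw [(h w hw).2, div_mul_cancel₀ _ (h w hw).1]

theorem isUnit (hy : y ∈ D) (hf : IsGermOf D α f) (h0 : f y ≠ 0) : IsUnit α := by
  obtain ⟨a, b, h1, h2, h3⟩ := hf
  have ha : eval y a ≠ 0 := by
    rw [← h3 y hy]
    exact mul_ne_zero h0 h1
  exact isUnit_of_mul_isUnit_left (h2 ▸ isUnit_algebraMap_of_eval_ne_zero ha)

/-- The zero germ only gives `f * b = 0`, which says nothing where `b` vanishes. Regularity of `f`
closes this gap: its numerator times `b` is the zero polynomial, and `b ≠ 0`. -/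
theorem eq_zero_of_zero (hD : IsOpen D) (hf : IsRegularOn D f)
    (h : IsGermOf D (y := y) 0 f) : ∀ w ∈ D, f w = 0 := by
  obtain ⟨a, b, h1, h2, h3⟩ := h
  have ha : a = 0 := algebraMap_atPrime_injective y (by rw [← h2, zero_mul, map_zero])
  obtain ⟨P, Q, hPQ⟩ := hf
  intro w hw
  have hP : P * b = 0 := eq_zero_of_eval_eq_zero hD ⟨w, hw⟩ fun v hv => by
    have := h3 v hv
    obtain ⟨hQ, hf⟩ := hPQ v hv
    rw [ha, map_zero, hf] at this
    field_simp at this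
    simpa using this
  have hb : b ≠ 0 := by rintro rfl; simp at h1
  have hP0 : P = 0 := (mul_eq_zero.1 hP).resolve_right hb
  rw [(hPQ w hw).2, hP0]
  simp

end IsGermOf

/-! ### Local rings at the points of a chart, and gluing of charts -/

namespace Chart

variable {V : Set (σ → ℂ)} {d : ℕ} (c : Chart V d)

/-- A polynomial that vanishes on a chart of an irreducible set vanishes on the whole set. -/
theorem mem_vanishingIdeal (hV : IsIrreducible V) (hne : (V ∩ c.nbhd).Nonempty)
    {P : MvPolynomial σ ℂ} (h : ∀ w ∈ c.dom, eval (c.param w) P = 0) :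
    P ∈ vanishingIdeal ℂ V := by
  intro z hz
  rw [aeval_eq_eval]
  by_contra hPz
  obtain ⟨v, hvV, hv, hPv⟩ := hV.2 _ _ c.isOpen_nbhd (isOpen_nonzeros P) hne ⟨z, hz, hPz⟩
  have := h _ (c.mapsTo_coord ⟨hvV, hv⟩)
  rw [c.param_coord _ ⟨hvV, hv⟩] at this
  exact hPv this

/-- The local ring of an irreducible set at a point of a chart is a local ring of `ℂ^d`. -/
theorem nonempty_localRing_ringEquiv (hV : IsIrreducible V) {x : σ → ℂ} (hx : x ∈ V ∩ c.nbhd) :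
    Nonempty (Localization.AtPrime
      (vanishingIdeal ℂ {c.coord x} : Ideal (MvPolynomial (Fin d) ℂ)) ≃+* LocalRing V x) := by
  set y := c.coord x with hy
  have hyD : y ∈ c.dom := c.mapsTo_coord hx
  have hxy : c.param y = x := c.param_coord x hx
  choose θ hθ using fun i => IsGermOf.exists_of_isRegularOn (c.regular_param i) hyD
  -- Pullback along the parametrization: each coordinate goes to the germ of the corresponding
  -- component of `c.param`.
  let Φ : MvPolynomial σ ℂ →+* Localization.AtPrime
      (vanishingIdeal ℂ {y} : Ideal (MvPolynomial (Fin d) ℂ)) := (aeval θ).toRingHom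
  have hΦ : ∀ P, IsGermOf c.dom (Φ P) (fun w => eval (c.param w) P) := by
    intro P
    induction P using MvPolynomial.induction_on with
    | C a =>
      have := IsGermOf.of_eval (D := c.dom) (y := y) (C a)
      simpa [Φ, IsScalarTower.algebraMap_apply ℂ (MvPolynomial (Fin d) ℂ)
        (Localization.AtPrime (vanishingIdeal ℂ {y} : Ideal (MvPolynomial (Fin d) ℂ)))] using this
    | add p q hp hq => simpa using hp.add hq
    | mul_X p i hp =>
      have := hp.mul (hθ i)
      simpa [Φ] using this
  -- Polynomials not vanishing at `x` pull back to units, so `Φ` extends to the local ring at `x`.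
  have hunit : ∀ b : (vanishingIdeal ℂ {x} : Ideal (MvPolynomial σ ℂ)).primeCompl,
      IsUnit (Φ b) := fun b =>
    (hΦ b).isUnit hyD (by rw [hxy]; exact eval_ne_zero_of_mem_primeCompl b)
  let Ψ : Localization.AtPrime (vanishingIdeal ℂ {x} : Ideal (MvPolynomial σ ℂ)) →+*
      Localization.AtPrime (vanishingIdeal ℂ {y} : Ideal (MvPolynomial (Fin d) ℂ)) :=
    IsLocalization.lift hunit
  have hΨ : ∀ P, Ψ (algebraMap _ _ P) = Φ P := IsLocalization.lift_eq hunit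
  -- The kernel consists of the polynomials vanishing on the chart; by irreducibility these vanish
  -- on all of `V`.
  have hzero : ∀ P, Φ P = 0 ↔ P ∈ vanishingIdeal ℂ V := by
    intro P
    constructor
    · intro h0
      have := hΦ P
      rw [h0] at this
      exact c.mem_vanishingIdeal hV ⟨x, hx⟩ (this.eq_zero_of_zero c.isOpen_dom
        (IsRegularOn.eval_comp c.regular_param P))
    · intro hP
      refine (hΦ P).unique c.isOpen_dom ⟨y, hyD⟩ (β := 0) (g := fun _ => 0)
        (by simpa using IsGermOf.of_eval (D := c.dom) (y := y) 0) fun w hw => ?_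
      simpa [aeval_eq_eval] using hP _ (c.mapsTo_param hw).1
  have hker : RingHom.ker Ψ = (vanishingIdeal ℂ V).map (algebraMap _ _) := by
    refine le_antisymm (fun α hα => ?_) (Ideal.map_le_iff_le_comap.2 fun P hP => ?_)
    · obtain ⟨P, Q, rfl⟩ := IsLocalization.exists_mk'_eq
        (vanishingIdeal ℂ {x} : Ideal (MvPolynomial σ ℂ)).primeCompl α
      rw [RingHom.mem_ker] at hα
      have h1 : Φ P = 0 := by
        rw [← hΨ, ← IsLocalization.mk'_spec (Localization.AtPrime
          (vanishingIdeal ℂ {x} : Ideal (MvPolynomial σ ℂ))) P Q, map_mul, hα, zero_mul]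
      rw [IsLocalization.mk'_eq_mul_mk'_one]
      exact Ideal.mul_mem_right _ _ (Ideal.mem_map_of_mem _ ((hzero P).1 h1))
    · rw [Ideal.mem_comap, RingHom.mem_ker, hΨ]
      exact (hzero P).2 hP
  -- For surjectivity, `a` composed with the coordinate map of the chart is a quotient `P / Q`,
  -- which pulls back to `a`.
  have hpoly : ∀ a : MvPolynomial (Fin d) ℂ, ∃ P Q : MvPolynomial σ ℂ, eval x Q ≠ 0 ∧
      eval x P = eval y a * eval x Q ∧ algebraMap _ _ a * Φ Q = Φ P := by
    intro a
    obtain ⟨P, Q, h⟩ := IsRegularOn.eval_comp c.regular_coord a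
    refine ⟨P, Q, (h x hx).1, ?_, ?_⟩
    · rw [eq_comm, ← eq_div_iff (h x hx).1]
      exact (h x hx).2
    · refine ((IsGermOf.of_eval a).mul (hΦ Q)).unique c.isOpen_dom ⟨y, hyD⟩ (hΦ P) fun w hw => ?_
      obtain ⟨h1, h2⟩ := h _ (c.mapsTo_param hw)
      beta_reduce at h2 ⊢
      rw [c.coord_param w hw] at h2
      rw [h2, div_mul_cancel₀ _ h1]
  have hsurj : Function.Surjective Ψ := by
    intro β
    obtain ⟨a, b, rfl⟩ := IsLocalization.exists_mk'_eq
      (vanishingIdeal ℂ {y} : Ideal (MvPolynomial (Fin d) ℂ)).primeCompl β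
    obtain ⟨P, Q, hQ, hP, hPQ⟩ := hpoly a
    obtain ⟨P', Q', hQ', hP', hPQ'⟩ := hpoly b
    have hb := eval_ne_zero_of_mem_primeCompl b
    have hden : eval x (Q * P') ≠ 0 := by
      rw [map_mul, hP']
      exact mul_ne_zero hQ (mul_ne_zero hb hQ')
    obtain ⟨u, hu⟩ := isUnit_algebraMap_of_eval_ne_zero hden
    -- The preimage of `a / b` is `(P / Q) / (P' / Q') = (P * Q') / (Q * P')`.
    refine ⟨algebraMap _ _ (P * Q') * ↑u⁻¹, ?_⟩
    have hu1 : Ψ ↑u⁻¹ * Φ (Q * P') = 1 := by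
      rw [← hΨ, ← hu, ← map_mul, Units.inv_mul, map_one]
    have hbu := isUnit_algebraMap_of_eval_ne_zero hb
    rw [eq_comm, IsLocalization.mk'_eq_iff_eq_mul, map_mul, hΨ]
    simp only [map_mul] at hu1 ⊢
    rw [← hPQ'] at hu1
    rw [← hPQ]
    linear_combination (- algebraMap _ (Localization.AtPrime
      (vanishingIdeal ℂ {y} : Ideal (MvPolynomial (Fin d) ℂ))) a) * hu1
  exact ⟨((Ideal.quotEquivOfEq hker.symm).trans
    (RingHom.quotientKerEquivOfSurjective hsurj)).symm⟩

theorem isRegularLocalRing (hV : IsIrreducible V) {x : σ → ℂ} (hx : x ∈ V ∩ c.nbhd) :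
    IsRegularLocalRing (LocalRing V x) := by
  obtain ⟨e⟩ := c.nonempty_localRing_ringEquiv hV hx
  exact IsRegularLocalRing.of_ringEquiv e

end Chart

/-- A locally closed set covered by charts, any two of which meet, is a smooth irreducible
variety. -/
theorem isSmoothIrreducibleOfDim_of_charts {V : Set (σ → ℂ)} {d : ℕ} {κ : Type*}
    (hV : IsLocallyClosed V) (hne : V.Nonempty) (c : κ → Chart V d)
    (hcover : ∀ x ∈ V, ∃ k, x ∈ (c k).nbhd)
    (hmeet : ∀ k l, ∃ x ∈ V, x ∈ (c k).nbhd ∧ x ∈ (c l).nbhd) :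
    IsSmoothIrreducibleOfDim V d := by
  -- `A` meets chart `k`. That chart is irreducible and meets chart `l`, so `A` also meets chart
  -- `l`, and inside chart `l` it meets `B`.
  have hirr : IsIrreducible V := by
    refine ⟨hne, ?_⟩
    rintro A B hA hB ⟨x, hx, hxA⟩ ⟨y, hy, hyB⟩
    obtain ⟨k, hk⟩ := hcover x hx
    obtain ⟨l, hl⟩ := hcover y hy
    obtain ⟨z, hz, hzk, hzl⟩ := hmeet k l
    obtain ⟨w, ⟨hw, -⟩, hwA, hwl⟩ := (c k).isPreirreducible A _ hA (c l).isOpen_nbhd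
      ⟨x, ⟨hx, hk⟩, hxA⟩ ⟨z, ⟨hz, hzk⟩, hzl⟩
    obtain ⟨v, ⟨hv, -⟩, hvA, hvB⟩ := (c l).isPreirreducible A B hA hB
      ⟨w, ⟨hw, hwl⟩, hwA⟩ ⟨y, ⟨hy, hl⟩, hyB⟩
    exact ⟨v, hv, hvA, hvB⟩
  refine ⟨⟨hV, fun x hx => ?_⟩, hirr, le_antisymm ?_ ?_⟩
  · obtain ⟨k, hk⟩ := hcover x hx
    exact (c k).isRegularLocalRing hirr ⟨hx, hk⟩
  · refine topologicalKrullDim_le_of_isOpen_cover fun x : V => ?_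
    obtain ⟨k, hk⟩ := hcover x x.2
    refine ⟨Subtype.val ⁻¹' (c k).nbhd, (c k).isOpen_nbhd.preimage continuous_subtype_val, hk,
      le_trans ?_ (c k).topologicalKrullDim_le⟩
    have hind := Topology.IsInducing.subtypeVal.comp (Topology.IsInducing.subtypeVal
      (t := (Subtype.val : V → σ → ℂ) ⁻¹' (c k).nbhd))
    exact ((Topology.IsInducing.of_comp_iff
      (f := fun z : ↥((Subtype.val : V → σ → ℂ) ⁻¹' (c k).nbhd) =>
        (⟨z, z.1.2, z.2⟩ : ↥(V ∩ (c k).nbhd))) Topology.IsInducing.subtypeVal).1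
      hind).topologicalKrullDim_le
  · obtain ⟨x, hx⟩ := hne
    obtain ⟨k, hk⟩ := hcover x hx
    exact (c k).le_topologicalKrullDim ⟨x, hx, hk⟩

end Variety

/-! ### Conjugacy classes of `2 × 2` matrices -/

namespace MatrixTwo

/-- Complex `2 × 2` matrices. -/
local notation "Mat" => Matrix (Fin 2) (Fin 2) ℂ

theorem isConj_of_mul_eq {A M P : Mat} (hP : P.det ≠ 0) (h : P * A = M * P) : IsConj A M := by
  obtain ⟨u, hu⟩ := (Matrix.isUnit_iff_isUnit_det P).2 (isUnit_iff_ne_zero.2 hP)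
  exact ⟨u, by rw [SemiconjBy, hu, h]⟩

theorem trace_eq_of_isConj {A M : Mat} (h : IsConj A M) : M.trace = A.trace := by
  obtain ⟨c, hc⟩ := h
  have : M = c * A * (↑c⁻¹ : Mat) := by
    rw [hc.eq, mul_assoc, Units.mul_inv, mul_one]
  rw [this, Matrix.trace_units_conj]

theorem det_eq_of_isConj {A M : Mat} (h : IsConj A M) : M.det = A.det := by
  obtain ⟨c, hc⟩ := h
  have : M = c * A * (↑c⁻¹ : Mat) := by
    rw [hc.eq, mul_assoc, Units.mul_inv, mul_one]
  rw [this, Matrix.det_units_conj]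

theorem isConj_neg_one_iff {A : Mat} : IsConj A (-1) ↔ A = -1 := by
  constructor
  · rintro ⟨c, hc⟩
    have h : (c : Mat) * A = c * (-1) := by rw [hc.eq]; simp
    exact c.isUnit.mul_left_cancel h
  · rintro rfl
    exact IsConj.refl _

/-- For distinct eigenvalues the characteristic polynomial determines the class. The columns of the
conjugating matrix are eigenvectors of `M`, read off from a nonzero off-diagonal entry; if there is
none, `M` is diagonal up to order. -/
theorem isConj_diagonal_iff {v : Fin 2 → ℂ} (hv : v 0 ≠ v 1) {M : Mat} :
    IsConj (Matrix.diagonal v) M ↔ M.trace = v 0 + v 1 ∧ M.det = v 0 * v 1 := by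
  constructor
  · intro h
    rw [trace_eq_of_isConj h, det_eq_of_isConj h]
    simp
  rintro ⟨ht, hd⟩
  rw [Matrix.trace_fin_two] at ht
  rw [Matrix.det_fin_two] at hd
  have h10 : v 1 - v 0 ≠ 0 := sub_ne_zero.2 hv.symm
  have h11 : M 1 1 = v 0 + v 1 - M 0 0 := by rw [← ht]; ring
  rw [h11] at hd
  by_cases hq : M 0 1 = 0
  · by_cases hr : M 1 0 = 0
    · have h0 : (M 0 0 - v 0) * (M 0 0 - v 1) = 0 := by
        rw [hq] at hd
        linear_combination -hd
      rcases mul_eq_zero.1 h0 with h | h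
      · rw [sub_eq_zero] at h
        refine isConj_of_mul_eq (P := 1) (by simp) ?_
        ext i j
        fin_cases i <;> fin_cases j <;> simp [hq, hr, h, h11]
      · rw [sub_eq_zero] at h
        refine isConj_of_mul_eq (P := !![0, 1; 1, 0]) (by simp [Matrix.det_fin_two]) ?_
        ext i j
        fin_cases i <;> fin_cases j <;> simp [hq, hr, h, h11, Matrix.mul_apply, Fin.sum_univ_two]
    · refine isConj_of_mul_eq (P := !![v 0 - M 1 1, v 1 - M 1 1; M 1 0, M 1 0]) ?_ ?_
      · rw [Matrix.det_fin_two_of]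
        intro h
        exact mul_ne_zero hr h10 (by linear_combination -h)
      · ext i j
        fin_cases i <;> fin_cases j <;> simp [Matrix.mul_apply, Fin.sum_univ_two, h11] <;>
          first | ring1 | linear_combination hd
  · refine isConj_of_mul_eq (P := !![M 0 1, M 0 1; v 0 - M 0 0, v 1 - M 0 0]) ?_ ?_
    · rw [Matrix.det_fin_two_of]
      intro h
      exact mul_ne_zero hq h10 (by linear_combination h)
    · ext i j
      fin_cases i <;> fin_cases j <;> simp [Matrix.mul_apply, Fin.sum_univ_two, h11] <;>
        first | ring1 | linear_combination hd

/-- The conjugating matrix has as second column a basis vector `e` with `(M + 1) e ≠ 0`, and as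
first column `(M + 1) e`, which is then an eigenvector. -/
theorem isConj_jordan_iff {M : Mat} :
    IsConj (!![-1, 1; 0, -1] : Mat) M ↔ M.trace = -2 ∧ M.det = 1 ∧ M ≠ -1 := by
  constructor
  · intro h
    refine ⟨?_, ?_, ?_⟩
    · rw [trace_eq_of_isConj h, Matrix.trace_fin_two_of]; norm_num
    · rw [det_eq_of_isConj h, Matrix.det_fin_two_of]; norm_num
    · rintro rfl
      have := congrFun (congrFun (isConj_neg_one_iff.1 h) 0) 1
      simp at this
  rintro ⟨ht, hd, hM⟩
  rw [Matrix.trace_fin_two] at ht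
  rw [Matrix.det_fin_two] at hd
  have h11 : M 1 1 = -2 - M 0 0 := by rw [← ht]; ring
  rw [h11] at hd
  by_cases hr : M 1 0 = 0
  · by_cases hq : M 0 1 = 0
    · refine absurd ?_ hM
      have h00 : M 0 0 = -1 := by
        have : (M 0 0 + 1) ^ 2 = 0 := by
          rw [hq] at hd
          linear_combination -hd
        linear_combination (pow_eq_zero_iff two_ne_zero).1 this
      ext i j
      fin_cases i <;> fin_cases j <;> simp [hq, hr, h00, h11]
      norm_num
    · refine isConj_of_mul_eq (P := !![M 0 1, 0; -(M 0 0 + 1), 1]) ?_ ?_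
      · simpa [Matrix.det_fin_two_of] using hq
      · ext i j
        fin_cases i <;> fin_cases j <;> simp [Matrix.mul_apply, Fin.sum_univ_two, h11] <;>
          first | ring1 | linear_combination hd
  · refine isConj_of_mul_eq (P := !![M 0 0 + 1, 1; M 1 0, 0]) ?_ ?_
    · simpa [Matrix.det_fin_two_of] using hr
    · ext i j
      fin_cases i <;> fin_cases j <;> simp [Matrix.mul_apply, Fin.sum_univ_two, h11] <;>
        first | ring1 | linear_combination hd

/-! ### Commuting matrices and eigenvectors -/

/-- A matrix that commutes with a non-scalar matrix `X` is a linear combination of `1` and `X`. -/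
theorem exists_eq_add_of_commute {X Y : Mat} (h : X * Y = Y * X)
    (hX : X 0 1 ≠ 0 ∨ X 1 1 ≠ X 0 0 ∨ X 1 0 ≠ 0) :
    ∃ α β : ℂ, Y = α • (1 : Mat) + β • X := by
  have e : ∀ i j, (X * Y) i j = (Y * X) i j := fun i j => by rw [h]
  have e00 := e 0 0
  have e01 := e 0 1
  have e10 := e 1 0
  simp only [Matrix.mul_apply, Fin.sum_univ_two] at e00 e01 e10
  -- Modulo scalar matrices, commuting means that the vectors of off-diagonal entries and diagonal
  -- difference are parallel; `β` is the ratio at a nonzero component for `X`.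
  suffices ∃ β : ℂ, Y 0 1 = β * X 0 1 ∧ Y 1 0 = β * X 1 0 ∧
      Y 1 1 - Y 0 0 = β * (X 1 1 - X 0 0) by
    obtain ⟨β, h01, h10, hd⟩ := this
    refine ⟨Y 0 0 - β * X 0 0, β, ?_⟩
    ext i j
    fin_cases i <;> fin_cases j <;> simp [h01, h10]
    linear_combination hd
  rcases hX with hX | hX | hX
  · refine ⟨Y 0 1 / X 0 1, ?_, ?_, ?_⟩ <;> field_simp
    · linear_combination e00
    · linear_combination e01
  · have hX' := sub_ne_zero.2 hX
    refine ⟨(Y 1 1 - Y 0 0) / (X 1 1 - X 0 0), ?_, ?_, ?_⟩ <;> field_simp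
    · linear_combination -e01
    · linear_combination e10
  · refine ⟨Y 1 0 / X 1 0, ?_, ?_, ?_⟩ <;> field_simp
    · linear_combination -e00
    · linear_combination -e10

theorem nonscalar_of_trace_det {X : Mat} {a b : ℂ} (hab : a ≠ b) (ht : X.trace = a + b)
    (hd : X.det = a * b) : X 0 1 ≠ 0 ∨ X 1 1 ≠ X 0 0 ∨ X 1 0 ≠ 0 := by
  by_contra! h
  obtain ⟨h1, h2, h3⟩ := h
  rw [Matrix.trace_fin_two, h2] at ht
  rw [Matrix.det_fin_two, h1, h2] at hd
  have : (a - b) ^ 2 = 0 := by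
    linear_combination (-(a + b) - 2 * X 0 0) * ht + 4 * hd
  exact hab (sub_eq_zero.1 ((pow_eq_zero_iff two_ne_zero).1 this))

/-- Cayley–Hamilton in factored form: the image of `X - a` lies in the `b`-eigenspace. -/
theorem sub_mul_sub_eq_zero {X : Mat} {a b : ℂ} (ht : X.trace = a + b) (hd : X.det = a * b) :
    (X - b • (1 : Mat)) * (X - a • (1 : Mat)) = 0 := by
  rw [Matrix.trace_fin_two] at ht
  rw [Matrix.det_fin_two] at hd
  ext i j
  fin_cases i <;> fin_cases j <;> simp [Matrix.mul_apply, Fin.sum_univ_two]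
  · linear_combination X 0 0 * ht - hd
  · linear_combination X 0 1 * ht
  · linear_combination X 1 0 * ht
  · linear_combination X 1 1 * ht - hd

/-- The difference of the two products is `(b - a) • (X * B - B * X)`. Geometrically, `B` preserves
both eigenlines of `X`. -/
theorem commute_of_sandwich_eq_zero {X B : Mat} {a b : ℂ} (hab : a ≠ b)
    (h1 : (X - b • (1 : Mat)) * B * (X - a • (1 : Mat)) = 0)
    (h2 : (X - a • (1 : Mat)) * B * (X - b • (1 : Mat)) = 0) : X * B = B * X := by
  have h : (b - a) • (X * B - B * X) = 0 := by
    rw [← sub_eq_zero.2 (h1.trans h2.symm)]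
    simp only [sub_mul, mul_sub, smul_mul_assoc, mul_smul_comm, one_mul, mul_one, sub_smul,
      smul_sub]
    rw [smul_comm b a B]
    abel
  exact sub_eq_zero.1 ((smul_eq_zero.1 h).resolve_left (sub_ne_zero.2 hab.symm))

theorem sandwich_eq_zero_of_commute {X B : Mat} {a b : ℂ} (ht : X.trace = a + b)
    (hd : X.det = a * b) (h : B * X = X * B) :
    (X - b • (1 : Mat)) * B * (X - a • (1 : Mat)) = 0 := by
  have : B * (X - a • (1 : Mat)) = (X - a • (1 : Mat)) * B := by
    rw [mul_sub, sub_mul, h]; simp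
  rw [mul_assoc, this, ← mul_assoc, sub_mul_sub_eq_zero ht hd, zero_mul]

theorem eigenvalue_eq {X : Mat} {a b μ : ℂ} {v : Fin 2 → ℂ} (ht : X.trace = a + b)
    (hd : X.det = a * b) (hv : v ≠ 0) (h : X.mulVec v = μ • v) : μ = a ∨ μ = b := by
  have h0 := congrArg (fun A : Mat => A.mulVec v) (sub_mul_sub_eq_zero ht hd)
  simp only [← Matrix.mulVec_mulVec, Matrix.sub_mulVec, Matrix.smul_mulVec, Matrix.one_mulVec,
    Matrix.zero_mulVec, h, ← sub_smul, Matrix.mulVec_smul, smul_smul] at h0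
  rw [← sub_eq_zero, ← sub_eq_zero (a := μ) (b := b)]
  exact mul_eq_zero.1 ((smul_eq_zero.1 h0).resolve_right hv)

theorem exists_eigenvector {X : Mat} {a b : ℂ} (ht : X.trace = a + b) (hd : X.det = a * b) :
    ∃ v : Fin 2 → ℂ, v ≠ 0 ∧ X.mulVec v = a • v := by
  have h0 : (X - a • (1 : Mat)).det = 0 := by
    rw [Matrix.trace_fin_two] at ht
    rw [Matrix.det_fin_two] at hd
    rw [Matrix.det_fin_two]
    simp
    linear_combination hd - a * ht
  obtain ⟨v, hv, h⟩ := Matrix.exists_mulVec_eq_zero_iff.2 h0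
  refine ⟨v, hv, ?_⟩
  rwa [Matrix.sub_mulVec, Matrix.smul_mulVec, Matrix.one_mulVec, sub_eq_zero] at h

/-! ### Conjugation by unipotent matrices -/

/-- The unipotent upper triangular matrices. -/
def unip (γ : ℂ) : Mat := !![1, γ; 0, 1]

theorem unip_mul (γ δ : ℂ) : unip γ * unip δ = unip (γ + δ) := by
  simp [unip, add_comm]

theorem unip_zero : unip 0 = 1 := by
  simp [unip, Matrix.one_fin_two]

theorem unip_neg_mul (γ : ℂ) : unip (-γ) * unip γ = 1 := by
  rw [unip_mul, neg_add_cancel, unip_zero]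

/-- Conjugation by a unipotent upper triangular matrix. -/
def conj (γ : ℂ) (X : Mat) : Mat := unip γ * X * unip (-γ)

theorem conj_mul (γ : ℂ) (X Y : Mat) : conj γ (X * Y) = conj γ X * conj γ Y := by
  simp only [conj]
  rw [show unip γ * X * unip (-γ) * (unip γ * Y * unip (-γ)) =
    unip γ * X * (unip (-γ) * unip γ) * Y * unip (-γ) by simp only [mul_assoc], unip_neg_mul]
  simp only [mul_assoc, one_mul]

theorem conj_one (γ : ℂ) : conj γ 1 = 1 := by
  rw [conj, mul_one, unip_mul, add_neg_cancel, unip_zero]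

theorem conj_smul (γ c : ℂ) (X : Mat) : conj γ (c • X) = c • conj γ X := by
  simp [conj]

theorem conj_sub (γ : ℂ) (X Y : Mat) : conj γ (X - Y) = conj γ X - conj γ Y := by
  simp [conj, mul_sub, sub_mul]

theorem conj_conj (γ δ : ℂ) (X : Mat) : conj γ (conj δ X) = conj (γ + δ) X := by
  simp only [conj]
  rw [show unip γ * (unip δ * X * unip (-δ)) * unip (-γ) =
    (unip γ * unip δ) * X * (unip (-δ) * unip (-γ)) by simp only [mul_assoc], unip_mul, unip_mul]
  congr 2
  ring

theorem conj_zero (X : Mat) : conj 0 X = X := by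
  simp [conj, unip_zero]

theorem det_conj (γ : ℂ) (X : Mat) : (conj γ X).det = X.det := by
  rw [conj, Matrix.det_mul, Matrix.det_mul, unip, unip, Matrix.det_fin_two_of,
    Matrix.det_fin_two_of]
  ring

theorem trace_conj (γ : ℂ) (X : Mat) : (conj γ X).trace = X.trace := by
  rw [conj, Matrix.trace_mul_comm, ← mul_assoc, unip_neg_mul, one_mul]

theorem adjugate_conj (γ : ℂ) (X : Mat) : (conj γ X).adjugate = conj γ X.adjugate := by
  have h : ∀ δ, (unip δ).adjugate = unip (-δ) := fun δ => by
    simp [unip, Matrix.adjugate_fin_two_of]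
  simp only [conj, Matrix.adjugate_mul_distrib, h, neg_neg, mul_assoc]

theorem conj_apply_zero_one (γ : ℂ) (X : Mat) :
    conj γ X 0 1 = X 0 1 + γ * (X 1 1 - X 0 0) - γ ^ 2 * X 1 0 := by
  simp only [conj, unip, Matrix.mul_apply, Fin.sum_univ_two, Matrix.of_apply, Matrix.cons_val]
  ring

/-- A generic unipotent conjugate of a non-scalar matrix is not lower triangular. -/
theorem finite_conj_apply_eq_zero {X : Mat} (hX : X 0 1 ≠ 0 ∨ X 1 1 ≠ X 0 0 ∨ X 1 0 ≠ 0) :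
    {γ : ℂ | conj γ X 0 1 = 0}.Finite := by
  let P : Polynomial ℂ := Polynomial.C (X 0 1) + Polynomial.C (X 1 1 - X 0 0) * Polynomial.X -
    Polynomial.C (X 1 0) * Polynomial.X ^ 2
  have hP : P ≠ 0 := by
    intro h
    have h0 := congrArg (fun p => Polynomial.coeff p 0) h
    have h1 := congrArg (fun p => Polynomial.coeff p 1) h
    have h2 := congrArg (fun p => Polynomial.coeff p 2) h
    simp [P, Polynomial.coeff_X, Polynomial.coeff_X_pow, Polynomial.coeff_C] at h0 h1 h2
    rcases hX with h | h | h
    · exact h h0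
    · exact h (sub_eq_zero.1 h1)
    · exact h h2
  refine (Polynomial.finite_setOfPred_isRoot hP).subset fun γ hγ => ?_
  simp only [Set.mem_ofPred_eq, conj_apply_zero_one] at hγ
  simp only [Set.mem_ofPred_eq, Polynomial.IsRoot, P]
  simp
  linear_combination hγ

end MatrixTwo

/-! ### Irreducibility of quadruples -/

namespace MatrixTwo

local notation "Mat" => Matrix (Fin 2) (Fin 2) ℂ

theorem mulVec_eq_inv_smul {A C : Mat} (h : C * A = 1) {v : Fin 2 → ℂ} (hv : v ≠ 0) {μ : ℂ}
    (hA : A.mulVec v = μ • v) : C.mulVec v = μ⁻¹ • v := by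
  have h1 : v = μ • C.mulVec v := by
    rw [← Matrix.mulVec_smul, ← hA, Matrix.mulVec_mulVec, h, Matrix.one_mulVec]
  have hμ : μ ≠ 0 := by
    rintro rfl
    exact hv (by rw [h1, zero_smul])
  rw [eq_inv_smul_iff₀ hμ]
  exact h1.symm

/-- A nonzero `v` in the image of `X - a` is a `b`-eigenvector. The vanishing product puts `B v`
into the kernel of `X - b` too, and this kernel is a line because `X` is not scalar. -/
theorem exists_common_eigenvector {X B : Mat} {a b : ℂ} (hab : a ≠ b) (ht : X.trace = a + b)
    (hd : X.det = a * b) (h : (X - b • (1 : Mat)) * B * (X - a • (1 : Mat)) = 0) :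
    ∃ v : Fin 2 → ℂ, v ≠ 0 ∧ X.mulVec v = b • v ∧ ∃ μ : ℂ, B.mulVec v = μ • v := by
  have hns := nonscalar_of_trace_det hab ht hd
  have hne : ∀ c : ℂ, X - c • (1 : Mat) ≠ 0 := by
    intro c hc
    rw [sub_eq_zero] at hc
    rw [hc] at hns
    simp at hns
  obtain ⟨w, hw⟩ : ∃ w, (X - a • (1 : Mat)).mulVec w ≠ 0 := by
    by_contra! hall
    exact hne a (Matrix.mulVec_injective (by ext1 w; simp [hall w]))
  set v := (X - a • (1 : Mat)).mulVec w with hv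
  have h1 : (X - b • (1 : Mat)).mulVec v = 0 := by
    rw [hv, Matrix.mulVec_mulVec, sub_mul_sub_eq_zero ht hd, Matrix.zero_mulVec]
  have h2 : (X - b • (1 : Mat)).mulVec (B.mulVec v) = 0 := by
    rw [hv, Matrix.mulVec_mulVec, Matrix.mulVec_mulVec, h, Matrix.zero_mulVec]
  refine ⟨v, hw, ?_, ?_⟩
  · rwa [Matrix.sub_mulVec, Matrix.smul_mulVec, Matrix.one_mulVec, sub_eq_zero] at h1
  set u := B.mulVec v with hu
  -- If `v` and `B v` were independent, `X - b` would kill a basis.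
  have hdet : v 0 * u 1 - u 0 * v 1 = 0 := by
    by_contra hdet
    refine hne b ?_
    have hP : IsUnit (!![v 0, u 0; v 1, u 1] : Mat) := by
      rw [Matrix.isUnit_iff_isUnit_det, Matrix.det_fin_two_of, isUnit_iff_ne_zero]
      exact hdet
    refine hP.mul_right_cancel ?_
    rw [zero_mul]
    have e1 := fun i => congrFun h1 i
    have e2 := fun i => congrFun h2 i
    simp only [Matrix.mulVec, dotProduct, Fin.sum_univ_two] at e1 e2
    ext i j
    fin_cases j <;> simp only [Matrix.mul_apply, Fin.sum_univ_two]
    · simpa using e1 i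
    · simpa using e2 i
  by_cases h0 : v 0 = 0
  · have hv1 : v 1 ≠ 0 := by
      intro hv1
      exact hw (by ext i; fin_cases i <;> simp [h0, hv1])
    refine ⟨u 1 / v 1, ?_⟩
    ext i
    fin_cases i <;> simp [h0, hv1]
    rw [h0] at hdet
    simpa [hv1] using hdet
  · refine ⟨u 0 / v 0, ?_⟩
    ext i
    fin_cases i <;> simp [h0]
    field_simp
    linear_combination hdet

end MatrixTwo

namespace Quadruple

open MatrixTwo

/-- The matrices have product `1` and the `j`-th one has characteristic polynomial
`(X - s j 0) * (X - s j 1)`. -/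
structure HasSpectra (s : Fin 4 → Fin 2 → ℂ) (M : Quadruple) : Prop where
  trace : ∀ j, (M j).trace = s j 0 + s j 1
  det : ∀ j, (M j).det = s j 0 * s j 1
  prod : M 0 * M 1 * M 2 * M 3 = 1

namespace HasSpectra

variable {s : Fin 4 → Fin 2 → ℂ} {M : Quadruple}

/-- The eigenvalues of the four matrices on `v` multiply to `1`, which is a non-genericity relation
with `m = 1`. -/
theorem no_common_eigenvector (hgen : IsGeneric s) (hM : HasSpectra s M) {v : Fin 2 → ℂ}
    (hv : v ≠ 0) (h : ∀ j, ∃ μ : ℂ, (M j).mulVec v = μ • v) : False := by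
  choose μ hμ using h
  have hk : ∀ j, ∃ k, μ j = s j k := fun j => by
    rcases eigenvalue_eq (hM.trace j) (hM.det j) hv (hμ j) with h | h
    · exact ⟨0, h⟩
    · exact ⟨1, h⟩
  choose k hk using hk
  refine hgen 1 (fun j => {k j}) one_pos (by norm_num) (fun j => by simp) ?_
  have hp := congrArg (fun A => Matrix.mulVec A v) hM.prod
  simp only [← Matrix.mulVec_mulVec, hμ, Matrix.mulVec_smul, smul_smul, Matrix.one_mulVec] at hp
  have h1 : (μ 3 * (μ 2 * (μ 1 * μ 0)) - 1) • v = 0 := by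
    rw [sub_smul, hp, one_smul, sub_self]
  have h2 := (smul_eq_zero.1 h1).resolve_right hv
  simp only [Finset.prod_singleton, Fin.prod_univ_four, ← hk]
  linear_combination h2

theorem isIrreducible (hgen : IsGeneric s) (hM : HasSpectra s M) : M.IsIrreducible := by
  intro W hW
  by_contra! hne
  obtain ⟨hbot, htop⟩ := hne
  have h1 : Module.finrank ℂ W = 1 := by
    have hlt := Submodule.finrank_lt htop
    have hpos : Module.finrank ℂ W ≠ 0 := fun h => hbot (Submodule.finrank_eq_zero.1 h)
    rw [Module.finrank_fin_fun] at hlt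
    omega
  obtain ⟨w, hw0, hw⟩ := finrank_eq_one_iff'.1 h1
  refine hM.no_common_eigenvector hgen (v := w) (by simpa using hw0) fun j => ?_
  obtain ⟨c, hc⟩ := hw ⟨_, hW j w w.2⟩
  exact ⟨c, (congrArg Subtype.val hc).symm⟩

end HasSpectra

end Quadruple

/-! ### Matrices of regular functions and quadruples as points of affine space -/

namespace Variety

attribute [local instance] Variety.zariski

variable {σ : Type*}

/-- All four entries are regular functions. -/
def IsMatrixRegularOn (S : Set (σ → ℂ)) (F : (σ → ℂ) → Matrix (Fin 2) (Fin 2) ℂ) : Prop :=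
  ∀ a b, IsRegularOn S (fun y => F y a b)

namespace IsMatrixRegularOn

variable {S T : Set (σ → ℂ)} {F G : (σ → ℂ) → Matrix (Fin 2) (Fin 2) ℂ}

theorem mono (hF : IsMatrixRegularOn T F) (h : S ⊆ T) : IsMatrixRegularOn S F :=
  fun a b => (hF a b).mono h

theorem of {a b c d : (σ → ℂ) → ℂ} (ha : IsRegularOn S a) (hb : IsRegularOn S b)
    (hc : IsRegularOn S c) (hd : IsRegularOn S d) :
    IsMatrixRegularOn S (fun y => !![a y, b y; c y, d y]) := by
  intro i j
  fin_cases i <;> fin_cases j <;> assumption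

theorem const (A : Matrix (Fin 2) (Fin 2) ℂ) : IsMatrixRegularOn S (fun _ => A) :=
  fun _ _ => IsRegularOn.const _

theorem mul (hF : IsMatrixRegularOn S F) (hG : IsMatrixRegularOn S G) :
    IsMatrixRegularOn S (fun y => F y * G y) := fun a b =>
  (((hF a 0).mul (hG 0 b)).add ((hF a 1).mul (hG 1 b))).congr fun y _ => by
    simp [Matrix.mul_apply, Fin.sum_univ_two]

theorem sub (hF : IsMatrixRegularOn S F) (hG : IsMatrixRegularOn S G) :
    IsMatrixRegularOn S (fun y => F y - G y) := fun a b =>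
  ((hF a b).sub (hG a b)).congr fun _ _ => rfl

theorem smul (c : ℂ) (hF : IsMatrixRegularOn S F) :
    IsMatrixRegularOn S (fun y => c • F y) := fun a b =>
  ((IsRegularOn.const c).mul (hF a b)).congr fun _ _ => rfl

theorem adjugate (hF : IsMatrixRegularOn S F) :
    IsMatrixRegularOn S (fun y => (F y).adjugate) := by
  simp only [Matrix.adjugate_fin_two]
  exact of (hF 1 1) (hF 0 1).neg (hF 1 0).neg (hF 0 0)

theorem conj (γ : ℂ) (hF : IsMatrixRegularOn S F) :
    IsMatrixRegularOn S (fun y => MatrixTwo.conj γ (F y)) :=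
  ((const _).mul hF).mul (const _)

end IsMatrixRegularOn

end Variety

namespace Quadruple

/-- The quadruple with given entries. -/
def ofCoords (z : Fin 4 × Fin 2 × Fin 2 → ℂ) : Quadruple :=
  fun j => Matrix.of fun a b => z (j, a, b)

theorem coords_ofCoords (z : Fin 4 × Fin 2 × Fin 2 → ℂ) : (ofCoords z).coords = z := rfl

theorem ofCoords_coords (M : Quadruple) : ofCoords M.coords = M := rfl

theorem mem_coords_image {Q : Set Quadruple} {z : Fin 4 × Fin 2 × Fin 2 → ℂ} :
    z ∈ coords '' Q ↔ ofCoords z ∈ Q :=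
  ⟨by rintro ⟨M, hM, rfl⟩; exact hM, fun h => ⟨_, h, rfl⟩⟩

theorem isMatrixRegularOn_ofCoords (S : Set (Fin 4 × Fin 2 × Fin 2 → ℂ)) (j : Fin 4) :
    Variety.IsMatrixRegularOn S (fun z => ofCoords z j) :=
  fun a b => Variety.IsRegularOn.coord (j, a, b)

theorem isRegularOn_coords {σ : Type*} {S : Set (σ → ℂ)} {F : (σ → ℂ) → Quadruple}
    (hF : ∀ j, Variety.IsMatrixRegularOn S (fun y => F y j)) (i : Fin 4 × Fin 2 × Fin 2) :
    Variety.IsRegularOn S (fun y => (F y).coords i) :=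
  hF i.1 i.2.1 i.2.2

/-- Simultaneous conjugation by a unipotent matrix. -/
def conj (γ : ℂ) (M : Quadruple) : Quadruple := fun j => MatrixTwo.conj γ (M j)

theorem conj_conj (γ δ : ℂ) (M : Quadruple) : conj γ (conj δ M) = conj (γ + δ) M :=
  funext fun _ => MatrixTwo.conj_conj _ _ _

theorem conj_zero (M : Quadruple) : conj 0 M = M :=
  funext fun _ => MatrixTwo.conj_zero _

/-- If a set of quadruples is stable under conjugation by unipotent matrices, it is enough to
have charts that contain generic unipotent conjugates of its points. -/
theorem isSmoothIrreducibleOfDim_of_charts {Q : Set Quadruple} {d : ℕ} {κ : Type*}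
    (hQ : @IsLocallyClosed _ (Variety.zariski _) (coords '' Q))
    (hconj : ∀ γ, ∀ M ∈ Q, conj γ M ∈ Q) (c : κ → Variety.Chart (coords '' Q) d)
    (hcover : ∀ M ∈ Q, ∃ k, {γ | (conj γ M).coords ∉ (c k).nbhd}.Finite)
    (hmeet : ∃ M ∈ Q, ∀ k, {γ | (conj γ M).coords ∉ (c k).nbhd}.Finite) :
    Variety.IsSmoothIrreducibleOfDim (coords '' Q) d := by
  obtain ⟨N, hN, hfin⟩ := hmeet
  have hreg : ∀ γ i, Variety.IsRegularOn Set.univ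
      (fun z : Fin 4 × Fin 2 × Fin 2 → ℂ => (conj γ (ofCoords z)).coords i) := fun γ =>
    isRegularOn_coords fun j => (isMatrixRegularOn_ofCoords _ j).conj γ
  have hmaps : ∀ γ, Set.MapsTo (fun z => (conj γ (ofCoords z)).coords) (coords '' Q)
      (coords '' Q) := fun γ z hz =>
    mem_coords_image.2 (hconj γ _ (mem_coords_image.1 hz))
  have hinv : ∀ γ δ : ℂ, γ + δ = 0 → ∀ z ∈ coords '' Q,
      (conj γ (ofCoords (conj δ (ofCoords z)).coords)).coords = z := fun γ δ h z _ => by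
    rw [ofCoords_coords, conj_conj, h, conj_zero, coords_ofCoords]
  -- The translate of chart `k` by `β` contains `M` exactly when `conj β M` lies in chart `k`.
  let c' : κ × ℂ → Variety.Chart (coords '' Q) d := fun kβ =>
    (c kβ.1).map (fun z => (conj (-kβ.2) (ofCoords z)).coords)
      (fun z => (conj kβ.2 (ofCoords z)).coords) (hreg _) (hreg _) (hmaps _) (hmaps _)
      (hinv _ _ (by ring)) (hinv _ _ (by ring))
  refine Variety.isSmoothIrreducibleOfDim_of_charts hQ ⟨_, N, hN, rfl⟩ c' ?_ ?_
  · rintro _ ⟨M, hM, rfl⟩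
    obtain ⟨k, hk⟩ := hcover M hM
    obtain ⟨γ, hγ⟩ := hk.infinite_compl.nonempty
    exact ⟨(k, γ), not_not.1 hγ⟩
  -- A conjugate `conj γ N` lies in both translates unless `β + γ` or `β' + γ` falls into a finite
  -- set.
  · rintro ⟨k, β⟩ ⟨l, β'⟩
    have h1 := (hfin k).preimage (f := fun γ => β + γ) (add_right_injective β).injOn
    have h2 := (hfin l).preimage (f := fun γ => β' + γ) (add_right_injective β').injOn
    obtain ⟨γ, hγ⟩ := (h1.union h2).infinite_compl.nonempty
    rw [Set.mem_compl_iff, Set.mem_union, not_or] at hγ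
    refine ⟨(conj γ N).coords, ⟨_, hconj γ N hN, rfl⟩, ?_, ?_⟩
    · have := not_not.1 hγ.1
      rw [← conj_conj] at this
      exact this
    · have := not_not.1 hγ.2
      rw [← conj_conj] at this
      exact this

theorem HasSpectra.conj {s : Fin 4 → Fin 2 → ℂ} {M : Quadruple} (hM : HasSpectra s M) (γ : ℂ) :
    HasSpectra s (M.conj γ) where
  trace j := (MatrixTwo.trace_conj γ _).trans (hM.trace j)
  det j := (MatrixTwo.det_conj γ _).trans (hM.det j)
  prod := by
    simp only [Quadruple.conj, ← MatrixTwo.conj_mul, hM.prod, MatrixTwo.conj_one]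

end Quadruple

namespace MatrixTwo

local notation "Mat" => Matrix (Fin 2) (Fin 2) ℂ

/-! ### Solving for a matrix with given spectrum -/

/-- The matrix with trace `T`, determinant `D` and first row `(p, q)`. -/
noncomputable def ofFirstRow (T D p q : ℂ) : Mat := !![p, q; (p * (T - p) - D) / q, T - p]

theorem trace_ofFirstRow (T D p q : ℂ) : (ofFirstRow T D p q).trace = T := by
  simp [ofFirstRow, Matrix.trace_fin_two_of]

theorem det_ofFirstRow (T D p : ℂ) {q : ℂ} (hq : q ≠ 0) : (ofFirstRow T D p q).det = D := by
  rw [ofFirstRow, Matrix.det_fin_two_of]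
  field_simp
  ring

theorem ofFirstRow_eq {X : Mat} (hX : X 0 1 ≠ 0) :
    ofFirstRow X.trace X.det (X 0 0) (X 0 1) = X := by
  ext i j
  fin_cases i <;> fin_cases j <;>
    simp [ofFirstRow, Matrix.trace_fin_two, Matrix.det_fin_two, hX]

/-- The determinant of `u` and `B u`, for `u = (1, y)`. -/
def slopeDet (B : Mat) (y : ℂ) : ℂ := B 1 0 + y * B 1 1 - y * (B 0 0 + y * B 0 1)

/-- The numerator of the upper right entry of the matrix `solveTrace a b t B y`. -/
def slopeNum (a b t : ℂ) (B : Mat) (y : ℂ) : ℂ :=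
  t - a * (B 0 0 + B 1 1) - (b - a) * (B 0 0 + y * B 0 1)

/-- The matrix `X` with eigenvalues `a` and `b`, the latter for the eigenvector `(1, y)`, such that
`B * X` has trace `t`. -/
noncomputable def solveTrace (a b t : ℂ) (B : Mat) (y : ℂ) : Mat :=
  !![b - y * (slopeNum a b t B y / slopeDet B y), slopeNum a b t B y / slopeDet B y;
    y * (b - a - y * (slopeNum a b t B y / slopeDet B y)),
    a + y * (slopeNum a b t B y / slopeDet B y)]

/-- The matrix that vanishes if the `b`-eigenvector of `X` is an eigenvector of `B`. -/
def sandwich (a b : ℂ) (X B : Mat) : Mat := (X - b • (1 : Mat)) * B * (X - a • (1 : Mat))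

section solveTrace

variable {a b t y : ℂ} {B X : Mat}

theorem trace_solveTrace : (solveTrace a b t B y).trace = a + b := by
  rw [solveTrace, Matrix.trace_fin_two_of]
  ring

theorem det_solveTrace : (solveTrace a b t B y).det = a * b := by
  rw [solveTrace, Matrix.det_fin_two_of]
  ring

/-- The trace of `B * X` is an affine function of the upper right entry of `X`, with slope `slopeDet
B y`; `slopeNum` is `t` minus its constant term. -/
theorem trace_mul_solveTrace (h : slopeDet B y ≠ 0) : (B * solveTrace a b t B y).trace = t := by
  have h1 : slopeNum a b t B y / slopeDet B y * slopeDet B y = slopeNum a b t B y :=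
    div_mul_cancel₀ _ h
  rw [solveTrace]
  generalize slopeNum a b t B y / slopeDet B y = v at h1 ⊢
  rw [slopeNum, slopeDet] at h1
  rw [Matrix.trace_fin_two]
  simp only [Matrix.mul_apply, Fin.sum_univ_two, Matrix.of_apply, Matrix.cons_val]
  linear_combination h1

/-- With `v` the upper right entry, `X - b` is a column with top entry `v` times the row `(-y, 1)`,
and `X - a` is the column `(1, y)` times a row ending in `v`. The middle factor is `(-y, 1) B (1, y)
= slopeDet B y`. -/
theorem sandwich_solveTrace :
    sandwich a b (solveTrace a b t B y) B 0 1 =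
      (solveTrace a b t B y 0 1) ^ 2 * slopeDet B y := by
  rw [solveTrace, sandwich, slopeDet]
  generalize slopeNum a b t B y / _ = v
  simp [Matrix.mul_apply, Fin.sum_univ_two]
  ring

/-- The slope of the `b`-eigenvector of `X` is `(b - X 0 0) / X 0 1`, which equals `(X 1 1 - a) / X
0 1` by the trace. -/
theorem sandwich_apply (ht : X.trace = a + b) (hX : X 0 1 ≠ 0) :
    sandwich a b X B 0 1 = (X 0 1) ^ 2 * slopeDet B ((X 1 1 - a) / X 0 1) := by
  rw [Matrix.trace_fin_two] at ht
  simp [sandwich, slopeDet, Matrix.mul_apply, Fin.sum_univ_two]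
  field_simp
  linear_combination (B 0 0 * X 0 1 + B 0 1 * (X 1 1 - a)) * ht

theorem slopeNum_eq (ht : X.trace = a + b) (hd : X.det = a * b) (hX : X 0 1 ≠ 0) :
    slopeNum a b (B * X).trace B ((X 1 1 - a) / X 0 1) =
      X 0 1 * slopeDet B ((X 1 1 - a) / X 0 1) := by
  rw [Matrix.trace_fin_two] at ht
  rw [Matrix.det_fin_two] at hd
  simp [slopeNum, slopeDet, Matrix.trace_fin_two, Matrix.mul_apply, Fin.sum_univ_two]
  field_simp
  linear_combination (B 0 0 * X 0 1 + B 0 1 * X 1 1) * ht - B 0 1 * hd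

theorem solveTrace_eq (ht : X.trace = a + b) (hd : X.det = a * b) (hX : X 0 1 ≠ 0)
    (hs : slopeDet B ((X 1 1 - a) / X 0 1) ≠ 0) :
    solveTrace a b (B * X).trace B ((X 1 1 - a) / X 0 1) = X := by
  rw [solveTrace, slopeNum_eq ht hd hX, mul_div_cancel_right₀ _ hs]
  rw [Matrix.trace_fin_two] at ht
  rw [Matrix.det_fin_two] at hd
  ext i j
  fin_cases i <;> fin_cases j <;> simp
  · field_simp
    linear_combination -ht
  · field_simp
    linear_combination hd - X 1 1 * ht
  · field_simp
    ring

theorem sandwich_conj (γ : ℂ) : sandwich a b (conj γ X) (conj γ B) = conj γ (sandwich a b X B) := by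
  simp only [sandwich, conj_mul, conj_sub, conj_smul, conj_one]

theorem det_sandwich (ht : X.trace = a + b) (hd : X.det = a * b) : (sandwich a b X B).det = 0 := by
  have h : (X - b • (1 : Mat)).det = 0 := by
    rw [Matrix.trace_fin_two] at ht
    rw [Matrix.det_fin_two] at hd
    rw [Matrix.det_fin_two]
    simp
    linear_combination hd - b * ht
  rw [sandwich, Matrix.det_mul, Matrix.det_mul, h, zero_mul, zero_mul]

/-- A singular scalar matrix is zero. Together with `det_sandwich` this lets
`finite_conj_apply_eq_zero` be applied to a nonzero `sandwich`. -/
theorem nonscalar_of_det_eq_zero (hd : X.det = 0) (hX : X ≠ 0) :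
    X 0 1 ≠ 0 ∨ X 1 1 ≠ X 0 0 ∨ X 1 0 ≠ 0 := by
  by_contra! h
  obtain ⟨h1, h2, h3⟩ := h
  rw [Matrix.det_fin_two, h1, h2, zero_mul, sub_zero, mul_self_eq_zero] at hd
  refine hX ?_
  ext i j
  fin_cases i <;> fin_cases j <;> simp [h1, h2, h3, hd]

end solveTrace

end MatrixTwo

/-! ### Regular dependence of the solved matrices on the parameters -/

namespace Variety.IsMatrixRegularOn

open MatrixTwo

attribute [local instance] Variety.zariski

variable {σ : Type*} {S : Set (σ → ℂ)} {F G : (σ → ℂ) → Matrix (Fin 2) (Fin 2) ℂ}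
  {p q y : (σ → ℂ) → ℂ}

theorem ofFirstRow (T D : ℂ) (hp : IsRegularOn S p) (hq : IsRegularOn S q)
    (h0 : ∀ w ∈ S, q w ≠ 0) : IsMatrixRegularOn S (fun w => ofFirstRow T D (p w) (q w)) :=
  of hp hq (((hp.mul ((IsRegularOn.const T).sub hp)).sub (IsRegularOn.const D)).div hq h0)
    ((IsRegularOn.const T).sub hp)

theorem slopeDet (hF : IsMatrixRegularOn S F) (hy : IsRegularOn S y) :
    IsRegularOn S (fun w => slopeDet (F w) (y w)) :=
  ((hF 1 0).add (hy.mul (hF 1 1))).sub (hy.mul ((hF 0 0).add (hy.mul (hF 0 1))))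

theorem slopeNum (a b t : ℂ) (hF : IsMatrixRegularOn S F) (hy : IsRegularOn S y) :
    IsRegularOn S (fun w => slopeNum a b t (F w) (y w)) :=
  ((IsRegularOn.const t).sub ((IsRegularOn.const a).mul ((hF 0 0).add (hF 1 1)))).sub
    ((IsRegularOn.const (b - a)).mul ((hF 0 0).add (hy.mul (hF 0 1))))

theorem solveTrace (a b t : ℂ) (hF : IsMatrixRegularOn S F) (hy : IsRegularOn S y)
    (h0 : ∀ w ∈ S, MatrixTwo.slopeDet (F w) (y w) ≠ 0) :
    IsMatrixRegularOn S (fun w => solveTrace a b t (F w) (y w)) := by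
  have hv := (hF.slopeNum a b t hy).div (hF.slopeDet hy) h0
  exact of ((IsRegularOn.const b).sub (hy.mul hv)) hv
    (hy.mul ((IsRegularOn.const (b - a)).sub (hy.mul hv))) ((IsRegularOn.const a).add (hy.mul hv))

theorem sandwich (a b : ℂ) (hF : IsMatrixRegularOn S F) (hG : IsMatrixRegularOn S G) :
    IsMatrixRegularOn S (fun w => sandwich a b (F w) (G w)) :=
  ((hF.sub (const _)).mul hG).mul (hF.sub (const _))

theorem isOpen_ne (hF : IsMatrixRegularOn Set.univ F) (i j : Fin 2) :
    IsOpen {w | F w i j ≠ 0} := by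
  simpa using (hF i j).isOpen_ne isOpen_univ

end Variety.IsMatrixRegularOn

/-! ### Inverses through the adjugate -/

namespace MatrixTwo

local notation "Mat" => Matrix (Fin 2) (Fin 2) ℂ

theorem trace_adjugate (A : Mat) : A.adjugate.trace = A.trace := by
  rw [Matrix.adjugate_fin_two, Matrix.trace_fin_two_of, Matrix.trace_fin_two, add_comm]

theorem det_adjugate (A : Mat) : A.adjugate.det = A.det := by
  simp [Matrix.det_adjugate]

theorem adjugate_adjugate (A : Mat) : A.adjugate.adjugate = A := by
  simp [Matrix.adjugate_adjugate A]

section inverse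

variable {A C : Mat} {k : ℂ}

theorem mul_smul_adjugate (h : A.det * k = 1) : A * (k • A.adjugate) = 1 := by
  rw [mul_smul_comm, Matrix.mul_adjugate, smul_smul, mul_comm k, h, one_smul]

theorem det_smul_adjugate (h : A.det * k = 1) : (k • A.adjugate).det = k := by
  rw [Matrix.det_smul, det_adjugate, Fintype.card_fin]
  linear_combination k * h

theorem smul_adjugate_eq (h : A * C = 1) (hC : C.det = k) : k • A.adjugate = C := by
  have hA : A.det * k = 1 := by rw [← hC, ← Matrix.det_mul, h, Matrix.det_one]
  calc k • A.adjugate = k • A.adjugate * (A * C) := by rw [h, mul_one]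
    _ = C := by
      rw [← mul_assoc, smul_mul_assoc, Matrix.adjugate_mul, smul_smul, mul_comm k, hA, one_smul,
        one_mul]

/-- If `C` is the inverse of `A` then the trace of `C` determines that of `A`. -/
theorem trace_eq_of_mul_eq_one (h : A * C = 1) : A.trace = C.trace * A.det := by
  have hdet : A.det * C.det = 1 := by rw [← Matrix.det_mul, h, Matrix.det_one]
  have hC := congrArg Matrix.trace (smul_adjugate_eq h rfl)
  rw [Matrix.trace_smul, trace_adjugate, smul_eq_mul] at hC
  linear_combination A.det * hC - A.trace * hdet

end inverse

end MatrixTwo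

/-! ### The two loci, and the five-parameter charts -/

namespace Quadruple

open MatrixTwo Variety

attribute [local instance] Variety.zariski

theorem HasSpectra.prod_eq_one {s : Fin 4 → Fin 2 → ℂ} {M : Quadruple} (hM : HasSpectra s M) :
    s 0 0 * s 0 1 * (s 1 0 * s 1 1) * (s 2 0 * s 2 1) * (s 3 0 * s 3 1) = 1 := by
  rw [← hM.det, ← hM.det, ← hM.det, ← hM.det, ← Matrix.det_mul, ← Matrix.det_mul,
    ← Matrix.det_mul, hM.prod, Matrix.det_one]

/-- The quadruples with given spectra whose last member is not `-1`. -/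
def nonscalarLocus (s : Fin 4 → Fin 2 → ℂ) : Set Quadruple :=
  {M | HasSpectra s M ∧ M 3 ≠ -1}

/-- The quadruples with given spectra whose last member is `-1`. -/
def scalarLocus (s : Fin 4 → Fin 2 → ℂ) : Set Quadruple :=
  {M | HasSpectra s M ∧ M 3 = -1}

theorem isClosed_hasSpectra (s : Fin 4 → Fin 2 → ℂ) :
    IsClosed {z | HasSpectra s (ofCoords z)} := by
  have hreg := isMatrixRegularOn_ofCoords Set.univ
  have hcl : ∀ {f : (Fin 4 × Fin 2 × Fin 2 → ℂ) → ℂ}, IsRegularOn Set.univ f → ∀ c : ℂ,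
      IsClosed {z | f z = c} := fun {f} hf c => by
    have := (hf.sub (IsRegularOn.const c)).isOpen_ne isOpen_univ
    simp only [Set.mem_univ, true_and, sub_ne_zero] at this
    exact ⟨this⟩
  have heq : {z | HasSpectra s (ofCoords z)} =
      (⋂ j, {z | ofCoords z j 0 0 + ofCoords z j 1 1 = s j 0 + s j 1}) ∩
      (⋂ j, {z | ofCoords z j 0 0 * ofCoords z j 1 1 - ofCoords z j 0 1 * ofCoords z j 1 0 =
        s j 0 * s j 1}) ∩
      (⋂ a, ⋂ b, {z | (ofCoords z 0 * ofCoords z 1 * ofCoords z 2 * ofCoords z 3) a b =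
        (1 : Matrix (Fin 2) (Fin 2) ℂ) a b}) := by
    ext z
    simp only [Set.mem_inter_iff, Set.mem_iInter, Set.mem_ofPred_eq, ← Matrix.trace_fin_two,
      ← Matrix.det_fin_two]
    exact ⟨fun h => ⟨⟨h.1, h.2⟩, fun a b => by rw [h.3]⟩,
      fun h => ⟨h.1.1, h.1.2, Matrix.ext h.2⟩⟩
  rw [heq]
  refine (IsClosed.inter (isClosed_iInter fun j => hcl ((hreg j 0 0).add (hreg j 1 1)) _)
    (isClosed_iInter fun j => hcl (((hreg j 0 0).mul (hreg j 1 1)).sub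
      ((hreg j 0 1).mul (hreg j 1 0))) _)).inter
    (isClosed_iInter fun a => isClosed_iInter fun b =>
      hcl (((((hreg 0).mul (hreg 1)).mul (hreg 2)).mul (hreg 3)) a b) _)

theorem isOpen_last_ne_neg_one : IsOpen {z | ofCoords z 3 ≠ -1} := by
  have heq : {z | ofCoords z 3 ≠ -1} =
      ⋃ a, ⋃ b, {z | (ofCoords z 3 - (-1 : Matrix (Fin 2) (Fin 2) ℂ)) a b ≠ 0} := by
    ext z
    simp only [Set.mem_ofPred_eq, Set.mem_iUnion]
    rw [← not_forall_not]
    simp only [not_exists, not_not]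
    rw [not_iff_not, ← sub_eq_zero, ← Matrix.ext_iff]
    rfl
  rw [heq]
  exact isOpen_iUnion fun a => isOpen_iUnion fun b =>
    ((isMatrixRegularOn_ofCoords _ 3).sub (IsMatrixRegularOn.const _)).isOpen_ne a b

theorem isLocallyClosed_nonscalarLocus (s : Fin 4 → Fin 2 → ℂ) :
    IsLocallyClosed (coords '' nonscalarLocus s) := by
  have : coords '' nonscalarLocus s =
      {z | ofCoords z 3 ≠ -1} ∩ {z | HasSpectra s (ofCoords z)} := by
    ext z
    rw [mem_coords_image]
    exact and_comm
  rw [this]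
  exact ⟨_, _, isOpen_last_ne_neg_one, isClosed_hasSpectra s, rfl⟩

theorem isLocallyClosed_scalarLocus (s : Fin 4 → Fin 2 → ℂ) :
    IsLocallyClosed (coords '' scalarLocus s) := by
  have : coords '' scalarLocus s =
      {z | HasSpectra s (ofCoords z)} ∩ {z | ofCoords z 3 ≠ -1}ᶜ := by
    ext z
    rw [mem_coords_image]
    simp [scalarLocus]
  rw [this]
  exact ((isClosed_hasSpectra s).inter isOpen_last_ne_neg_one.isClosed_compl).isLocallyClosed

/-! ### The charts -/

/-- The quadruples in the chart of `nonscalarLocus s`. -/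
def chartSet (a b : ℂ) : Set Quadruple :=
  {M | ((M 0 0 1 ≠ 0 ∧ M 1 0 1 ≠ 0) ∧ M 2 0 1 ≠ 0) ∧ sandwich a b (M 2) (M 0 * M 1) 0 1 ≠ 0}

theorem isOpen_chartSet (a b : ℂ) : IsOpen (ofCoords ⁻¹' chartSet a b) :=
  have h := isMatrixRegularOn_ofCoords Set.univ
  ((((h 0).isOpen_ne 0 1).inter ((h 1).isOpen_ne 0 1)).inter ((h 2).isOpen_ne 0 1)).inter
    (((h 2).sandwich a b ((h 0).mul (h 1))).isOpen_ne 0 1)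

/-- The trace of the product of the first three members. -/
def chartTrace (s : Fin 4 → Fin 2 → ℂ) : ℂ :=
  (s 3 0 + s 3 1) * (s 0 0 * s 0 1 * (s 1 0 * s 1 1) * (s 2 0 * s 2 1))

/-- The product of the first two members, in the chart. -/
noncomputable def chartBase (s : Fin 4 → Fin 2 → ℂ) (y : Fin 5 → ℂ) : Matrix (Fin 2) (Fin 2) ℂ :=
  ofFirstRow (s 0 0 + s 0 1) (s 0 0 * s 0 1) (y 0) (y 1) *
    ofFirstRow (s 1 0 + s 1 1) (s 1 0 * s 1 1) (y 2) (y 3)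

/-- The third member, in the chart. -/
noncomputable def chartThird (s : Fin 4 → Fin 2 → ℂ) (a b : ℂ) (y : Fin 5 → ℂ) :
    Matrix (Fin 2) (Fin 2) ℂ :=
  solveTrace a b (chartTrace s) (chartBase s y) (y 4)

/-- The parametrization of the chart. -/
noncomputable def chartParam (s : Fin 4 → Fin 2 → ℂ) (a b : ℂ) (y : Fin 5 → ℂ) : Quadruple :=
  ![ofFirstRow (s 0 0 + s 0 1) (s 0 0 * s 0 1) (y 0) (y 1),
    ofFirstRow (s 1 0 + s 1 1) (s 1 0 * s 1 1) (y 2) (y 3),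
    chartThird s a b y,
    (s 3 0 * s 3 1) • (chartBase s y * chartThird s a b y).adjugate]

/-- The coordinates of the chart. -/
noncomputable def chartCoord (a : ℂ) (M : Quadruple) : Fin 5 → ℂ :=
  ![M 0 0 0, M 0 0 1, M 1 0 0, M 1 0 1, (M 2 1 1 - a) / M 2 0 1]

/-- The domain of the parametrization where the first two members are regular. -/
def chartDomBase : Set (Fin 5 → ℂ) := {y | y 1 ≠ 0 ∧ y 3 ≠ 0}

/-- The domain of the parametrization where the third member is regular. -/
def chartDomThird (s : Fin 4 → Fin 2 → ℂ) : Set (Fin 5 → ℂ) :=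
  {y | y ∈ chartDomBase ∧ slopeDet (chartBase s y) (y 4) ≠ 0}

/-- The domain of the parametrization. -/
def chartDom (s : Fin 4 → Fin 2 → ℂ) (a b : ℂ) : Set (Fin 5 → ℂ) :=
  {y | y ∈ chartDomThird s ∧ slopeNum a b (chartTrace s) (chartBase s y) (y 4) ≠ 0}

theorem isMatrixRegularOn_chartBase (s : Fin 4 → Fin 2 → ℂ) :
    IsMatrixRegularOn chartDomBase (chartBase s) :=
  (IsMatrixRegularOn.ofFirstRow _ _ (.coord 0) (.coord 1) fun _ h => h.1).mul
    (IsMatrixRegularOn.ofFirstRow _ _ (.coord 2) (.coord 3) fun _ h => h.2)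

theorem isMatrixRegularOn_chartThird (s : Fin 4 → Fin 2 → ℂ) (a b : ℂ) :
    IsMatrixRegularOn (chartDomThird s) (chartThird s a b) :=
  ((isMatrixRegularOn_chartBase s).mono fun _ h => h.1).solveTrace a b _ (.coord 4) fun _ h => h.2

theorem isMatrixRegularOn_chartParam (s : Fin 4 → Fin 2 → ℂ) (a b : ℂ) (j : Fin 4) :
    IsMatrixRegularOn (chartDomThird s) (fun y => chartParam s a b y j) := by
  fin_cases j
  · exact IsMatrixRegularOn.ofFirstRow _ _ (.coord 0) (.coord 1) fun _ h => h.1.1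
  · exact IsMatrixRegularOn.ofFirstRow _ _ (.coord 2) (.coord 3) fun _ h => h.1.2
  · exact isMatrixRegularOn_chartThird s a b
  · exact ((((isMatrixRegularOn_chartBase s).mono fun _ h => h.1).mul
      (isMatrixRegularOn_chartThird s a b)).adjugate).smul _

theorem isOpen_chartDom (s : Fin 4 → Fin 2 → ℂ) (a b : ℂ) : IsOpen (chartDom s a b) := by
  have h0 : IsOpen chartDomBase := by
    have h := (IsRegularOn.coord (S := {y : Fin 5 → ℂ | y ∈ Set.univ ∧ y 1 ≠ 0}) 3).isOpen_ne
      ((IsRegularOn.coord 1).isOpen_ne isOpen_univ)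
    simpa [chartDomBase] using h
  have h1 : IsOpen (chartDomThird s) :=
    ((isMatrixRegularOn_chartBase s).slopeDet (.coord 4)).isOpen_ne h0
  exact (((isMatrixRegularOn_chartBase s).mono fun _ h => h.1).slopeNum a b _
    (.coord 4)).isOpen_ne h1

section chart

variable {s : Fin 4 → Fin 2 → ℂ} {a b : ℂ} {y : Fin 5 → ℂ} {M : Quadruple}

theorem chartThird_apply_ne_zero (hy : y ∈ chartDom s a b) : chartThird s a b y 0 1 ≠ 0 := by
  simpa [chartThird, solveTrace] using ⟨hy.2, hy.1.2⟩

/-- The last member is built as an inverse, so only its trace needs an argument: it is its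
determinant times the trace of the product of the others, and `chartTrace` is chosen accordingly. -/
theorem hasSpectra_chartParam (hprod : s 0 0 * s 0 1 * (s 1 0 * s 1 1) * (s 2 0 * s 2 1) *
    (s 3 0 * s 3 1) = 1) (hadd : a + b = s 2 0 + s 2 1) (hmul : a * b = s 2 0 * s 2 1)
    (hy : y ∈ chartDom s a b) : HasSpectra s (chartParam s a b y) := by
  have h0 := det_ofFirstRow (s 0 0 + s 0 1) (s 0 0 * s 0 1) (y 0) hy.1.1.1
  have h1 := det_ofFirstRow (s 1 0 + s 1 1) (s 1 0 * s 1 1) (y 2) hy.1.1.2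
  have h2 : (chartThird s a b y).det = s 2 0 * s 2 1 := det_solveTrace.trans hmul
  have hdet : (chartBase s y * chartThird s a b y).det * (s 3 0 * s 3 1) = 1 := by
    rw [Matrix.det_mul, chartBase, Matrix.det_mul, h0, h1, h2, hprod]
  have htr : (chartBase s y * chartThird s a b y).trace = chartTrace s :=
    trace_mul_solveTrace hy.1.2
  constructor
  · intro j
    fin_cases j
    · exact trace_ofFirstRow _ _ _ _
    · exact trace_ofFirstRow _ _ _ _
    · exact trace_solveTrace.trans hadd
    · change ((s 3 0 * s 3 1) • (chartBase s y * chartThird s a b y).adjugate).trace =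
        s 3 0 + s 3 1
      rw [Matrix.trace_smul, trace_adjugate, htr, chartTrace, smul_eq_mul]
      linear_combination (s 3 0 + s 3 1) * hprod
  · intro j
    fin_cases j
    · exact h0
    · exact h1
    · exact h2
    · exact det_smul_adjugate hdet
  · exact mul_smul_adjugate hdet

theorem chartParam_mem_chartSet (hy : y ∈ chartDom s a b) :
    chartParam s a b y ∈ chartSet a b := by
  refine ⟨⟨hy.1.1, chartThird_apply_ne_zero hy⟩, ?_⟩
  change sandwich a b (chartThird s a b y) (chartBase s y) 0 1 ≠ 0
  rw [chartThird, sandwich_solveTrace]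
  exact mul_ne_zero (pow_ne_zero _ (chartThird_apply_ne_zero hy)) hy.1.2

/-- If `M 3 = -1`, then `M 2` is minus the inverse of `M 0 * M 1`, so the two commute and the
`sandwich` vanishes. The chart thus avoids the scalar locus by itself. -/
theorem last_ne_neg_one (hM : HasSpectra s M) (hadd : a + b = s 2 0 + s 2 1)
    (hmul : a * b = s 2 0 * s 2 1) (h : M ∈ chartSet a b) : M 3 ≠ -1 := by
  intro h3
  have h1 := hM.prod
  rw [h3, mul_neg, mul_one, neg_eq_iff_eq_neg] at h1
  have h2 : M 2 * (M 0 * M 1) = -1 := by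
    rw [← neg_eq_iff_eq_neg] at h1 ⊢
    rw [← mul_neg]
    rw [← neg_mul] at h1
    exact mul_eq_one_comm.1 h1
  refine h.2 ?_
  rw [sandwich, sandwich_eq_zero_of_commute ((hM.trace 2).trans hadd.symm)
    ((hM.det 2).trans hmul.symm) (h1.trans h2.symm)]
  rfl

theorem HasSpectra.trace_base (hM : HasSpectra s M) :
    (M 0 * M 1 * M 2).trace = chartTrace s := by
  rw [trace_eq_of_mul_eq_one hM.prod, chartTrace, Matrix.det_mul, Matrix.det_mul, hM.det, hM.det,
    hM.det, hM.trace]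

theorem slopeDet_ne_zero (hM : HasSpectra s M) (hadd : a + b = s 2 0 + s 2 1)
    (h : M ∈ chartSet a b) : slopeDet (M 0 * M 1) ((M 2 1 1 - a) / M 2 0 1) ≠ 0 := by
  have := h.2
  rw [sandwich_apply ((hM.trace 2).trans hadd.symm) h.1.2] at this
  exact right_ne_zero_of_mul this

theorem chartBase_chartCoord (hM : HasSpectra s M) (h : M ∈ chartSet a b) :
    chartBase s (chartCoord a M) = M 0 * M 1 := by
  rw [chartBase, ← hM.trace, ← hM.det, ← hM.trace, ← hM.det]
  exact congrArg₂ (· * ·) (ofFirstRow_eq h.1.1.1) (ofFirstRow_eq h.1.1.2)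

theorem chartCoord_mem_chartDom (hM : HasSpectra s M) (hadd : a + b = s 2 0 + s 2 1)
    (hmul : a * b = s 2 0 * s 2 1) (h : M ∈ chartSet a b) : chartCoord a M ∈ chartDom s a b := by
  refine ⟨⟨h.1.1, ?_⟩, ?_⟩
  · rw [chartBase_chartCoord hM h]
    exact slopeDet_ne_zero hM hadd h
  · rw [chartBase_chartCoord hM h, ← hM.trace_base]
    change slopeNum _ _ _ _ ((M 2 1 1 - a) / M 2 0 1) ≠ 0
    rw [slopeNum_eq ((hM.trace 2).trans hadd.symm) ((hM.det 2).trans hmul.symm) h.1.2]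
    exact mul_ne_zero h.1.2 (slopeDet_ne_zero hM hadd h)

theorem chartParam_chartCoord (hM : HasSpectra s M) (hadd : a + b = s 2 0 + s 2 1)
    (hmul : a * b = s 2 0 * s 2 1) (h : M ∈ chartSet a b) :
    chartParam s a b (chartCoord a M) = M := by
  have h2 : chartThird s a b (chartCoord a M) = M 2 := by
    rw [chartThird, chartBase_chartCoord hM h, ← hM.trace_base]
    exact solveTrace_eq ((hM.trace 2).trans hadd.symm) ((hM.det 2).trans hmul.symm) h.1.2
      (slopeDet_ne_zero hM hadd h)
  funext j
  fin_cases j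
  · change ofFirstRow _ _ _ _ = M 0
    rw [← hM.trace, ← hM.det]
    exact ofFirstRow_eq h.1.1.1
  · change ofFirstRow _ _ _ _ = M 1
    rw [← hM.trace, ← hM.det]
    exact ofFirstRow_eq h.1.1.2
  · exact h2
  · change (s 3 0 * s 3 1) • Matrix.adjugate _ = M 3
    rw [h2, chartBase_chartCoord hM h]
    exact smul_adjugate_eq hM.prod (hM.det 3)

theorem chartCoord_chartParam (hy : y ∈ chartDom s a b) :
    chartCoord a (chartParam s a b y) = y := by
  funext k
  fin_cases k
  · rfl
  · rfl
  · rfl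
  · rfl
  · change (chartThird s a b y 1 1 - a) / chartThird s a b y 0 1 = y 4
    rw [div_eq_iff (chartThird_apply_ne_zero hy)]
    simp [chartThird, solveTrace]

end chart

/-- The chart of `nonscalarLocus s` for an ordering `a`, `b` of the eigenvalues of the third
member. -/
noncomputable def nonscalarChart (s : Fin 4 → Fin 2 → ℂ) (a b : ℂ)
    (hprod : s 0 0 * s 0 1 * (s 1 0 * s 1 1) * (s 2 0 * s 2 1) * (s 3 0 * s 3 1) = 1)
    (hadd : a + b = s 2 0 + s 2 1) (hmul : a * b = s 2 0 * s 2 1) :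
    Chart (coords '' nonscalarLocus s) 5 where
  dom := chartDom s a b
  nbhd := ofCoords ⁻¹' chartSet a b
  param y := (chartParam s a b y).coords
  coord z := chartCoord a (ofCoords z)
  isOpen_dom := isOpen_chartDom s a b
  isOpen_nbhd := isOpen_chartSet a b
  regular_param := isRegularOn_coords fun j =>
    (isMatrixRegularOn_chartParam s a b j).mono fun _ h => h.1
  regular_coord k := by
    have h := isMatrixRegularOn_ofCoords (coords '' nonscalarLocus s ∩ ofCoords ⁻¹' chartSet a b)
    fin_cases k
    · exact h 0 0 0
    · exact h 0 0 1
    · exact h 1 0 0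
    · exact h 1 0 1
    · exact ((h 2 1 1).sub (.const a)).div (h 2 0 1) fun _ hz => hz.2.1.2
  mapsTo_param y hy := by
    have h1 := hasSpectra_chartParam hprod hadd hmul hy
    have h2 := chartParam_mem_chartSet hy
    exact ⟨⟨_, ⟨h1, last_ne_neg_one h1 hadd hmul h2⟩, rfl⟩, h2⟩
  mapsTo_coord z hz := chartCoord_mem_chartDom (mem_coords_image.1 hz.1).1 hadd hmul hz.2
  coord_param y hy := chartCoord_chartParam hy
  param_coord z hz := by
    rw [chartParam_chartCoord (mem_coords_image.1 hz.1).1 hadd hmul hz.2, coords_ofCoords]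

/-- Generic unipotent conjugates lie in the chart. -/
theorem finite_conj_notMem_chartSet {s : Fin 4 → Fin 2 → ℂ} (hs : ∀ j, j ≠ 3 → s j 0 ≠ s j 1)
    {M : Quadruple} (hM : HasSpectra s M) {a b : ℂ} (hadd : a + b = s 2 0 + s 2 1)
    (hmul : a * b = s 2 0 * s 2 1) (h : sandwich a b (M 2) (M 0 * M 1) ≠ 0) :
    {γ | M.conj γ ∉ chartSet a b}.Finite := by
  have hj : ∀ j, j ≠ 3 → {γ | MatrixTwo.conj γ (M j) 0 1 = 0}.Finite := fun j hj =>
    finite_conj_apply_eq_zero (nonscalar_of_trace_det (hs j hj) (hM.trace j) (hM.det j))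
  have h4 := finite_conj_apply_eq_zero (nonscalar_of_det_eq_zero
    (det_sandwich ((hM.trace 2).trans hadd.symm) ((hM.det 2).trans hmul.symm)) h)
  refine ((((hj 0 (by decide)).union (hj 1 (by decide))).union (hj 2 (by decide))).union h4).subset
    fun γ hγ => ?_
  by_contra hγ'
  simp only [Set.mem_union, not_or] at hγ'
  refine hγ ⟨hγ'.1, ?_⟩
  have := hγ'.2
  rw [Set.mem_ofPred_eq, ← sandwich_conj, MatrixTwo.conj_mul] at this
  exact this

end Quadruple

namespace Quadruple

open MatrixTwo Variety

attribute [local instance] Variety.zariski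

/-! ### The scalar case -/

/-- The quadruples in the chart of `scalarLocus s`. -/
def scalarChartSet (a b : ℂ) : Set Quadruple :=
  {M | (M 0 0 1 ≠ 0 ∧ M 1 0 1 ≠ 0) ∧ sandwich a b (M 1) (M 0) 0 1 ≠ 0}

theorem isOpen_scalarChartSet (a b : ℂ) : IsOpen (ofCoords ⁻¹' scalarChartSet a b) :=
  have h := isMatrixRegularOn_ofCoords Set.univ
  (((h 0).isOpen_ne 0 1).inter ((h 1).isOpen_ne 0 1)).inter
    (((h 1).sandwich a b (h 0)).isOpen_ne 0 1)

/-- The trace of the product of the first two members. -/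
def scalarChartTrace (s : Fin 4 → Fin 2 → ℂ) : ℂ :=
  -(s 2 0 + s 2 1) * (s 0 0 * s 0 1 * (s 1 0 * s 1 1))

/-- The first member, in the chart. -/
noncomputable def scalarChartFirst (s : Fin 4 → Fin 2 → ℂ) (y : Fin 3 → ℂ) :
    Matrix (Fin 2) (Fin 2) ℂ :=
  ofFirstRow (s 0 0 + s 0 1) (s 0 0 * s 0 1) (y 0) (y 1)

/-- The second member, in the chart. -/
noncomputable def scalarChartSecond (s : Fin 4 → Fin 2 → ℂ) (a b : ℂ) (y : Fin 3 → ℂ) :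
    Matrix (Fin 2) (Fin 2) ℂ :=
  solveTrace a b (scalarChartTrace s) (scalarChartFirst s y) (y 2)

/-- The parametrization of the chart. -/
noncomputable def scalarChartParam (s : Fin 4 → Fin 2 → ℂ) (a b : ℂ) (y : Fin 3 → ℂ) :
    Quadruple :=
  ![scalarChartFirst s y, scalarChartSecond s a b y,
    (-1 : ℂ) • ((s 2 0 * s 2 1) • (scalarChartFirst s y * scalarChartSecond s a b y).adjugate), -1]

/-- The coordinates of the chart. -/
noncomputable def scalarChartCoord (a : ℂ) (M : Quadruple) : Fin 3 → ℂ :=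
  ![M 0 0 0, M 0 0 1, (M 1 1 1 - a) / M 1 0 1]

/-- The domain of the parametrization where the second member is regular. -/
def scalarChartDomSecond (s : Fin 4 → Fin 2 → ℂ) : Set (Fin 3 → ℂ) :=
  {y | y ∈ {y | y ∈ Set.univ ∧ y 1 ≠ 0} ∧ slopeDet (scalarChartFirst s y) (y 2) ≠ 0}

/-- The domain of the parametrization. -/
def scalarChartDom (s : Fin 4 → Fin 2 → ℂ) (a b : ℂ) : Set (Fin 3 → ℂ) :=
  {y | y ∈ scalarChartDomSecond s ∧
    slopeNum a b (scalarChartTrace s) (scalarChartFirst s y) (y 2) ≠ 0}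

theorem isMatrixRegularOn_scalarChartFirst (s : Fin 4 → Fin 2 → ℂ) :
    IsMatrixRegularOn {y | y ∈ Set.univ ∧ y 1 ≠ 0} (scalarChartFirst s) :=
  IsMatrixRegularOn.ofFirstRow _ _ (.coord 0) (.coord 1) fun _ h => h.2

theorem isMatrixRegularOn_scalarChartSecond (s : Fin 4 → Fin 2 → ℂ) (a b : ℂ) :
    IsMatrixRegularOn (scalarChartDomSecond s) (scalarChartSecond s a b) :=
  ((isMatrixRegularOn_scalarChartFirst s).mono fun _ h => h.1).solveTrace a b _ (.coord 2)
    fun _ h => h.2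

theorem isMatrixRegularOn_scalarChartParam (s : Fin 4 → Fin 2 → ℂ) (a b : ℂ) (j : Fin 4) :
    IsMatrixRegularOn (scalarChartDomSecond s) (fun y => scalarChartParam s a b y j) := by
  have h0 := (isMatrixRegularOn_scalarChartFirst s).mono
    (S := scalarChartDomSecond s) fun _ h => h.1
  have h1 := isMatrixRegularOn_scalarChartSecond s a b
  fin_cases j
  · exact h0
  · exact h1
  · exact (((h0.mul h1).adjugate).smul _).smul _
  · exact IsMatrixRegularOn.const _

theorem isOpen_scalarChartDom (s : Fin 4 → Fin 2 → ℂ) (a b : ℂ) :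
    IsOpen (scalarChartDom s a b) := by
  have h0 := (IsRegularOn.coord (σ := Fin 3) 1).isOpen_ne isOpen_univ
  have h1 : IsOpen (scalarChartDomSecond s) :=
    ((isMatrixRegularOn_scalarChartFirst s).slopeDet (.coord 2)).isOpen_ne h0
  exact (((isMatrixRegularOn_scalarChartFirst s).mono fun _ h => h.1).slopeNum a b _
    (.coord 2)).isOpen_ne h1

/-- With last member `-1` the third is `-(A * B)⁻¹`, so the trace of `A * B` is the only condition
coupling the pair. -/
theorem hasSpectra_of_pair {s : Fin 4 → Fin 2 → ℂ}
    (hprod : s 0 0 * s 0 1 * (s 1 0 * s 1 1) * (s 2 0 * s 2 1) = 1) (hs : ∀ k, s 3 k = -1)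
    {A B : Matrix (Fin 2) (Fin 2) ℂ} (hAt : A.trace = s 0 0 + s 0 1) (hAd : A.det = s 0 0 * s 0 1)
    (hBt : B.trace = s 1 0 + s 1 1) (hBd : B.det = s 1 0 * s 1 1)
    (htr : (A * B).trace = scalarChartTrace s) :
    HasSpectra s ![A, B, (-1 : ℂ) • ((s 2 0 * s 2 1) • (A * B).adjugate), -1] := by
  have hdet : (A * B).det * (s 2 0 * s 2 1) = 1 := by rw [Matrix.det_mul, hAd, hBd, hprod]
  refine ⟨?_, ?_, ?_⟩
  · intro j
    fin_cases j
    · exact hAt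
    · exact hBt
    · change ((-1 : ℂ) • ((s 2 0 * s 2 1) • (A * B).adjugate)).trace = s 2 0 + s 2 1
      rw [Matrix.trace_smul, Matrix.trace_smul, trace_adjugate, htr, scalarChartTrace,
        smul_eq_mul, smul_eq_mul]
      linear_combination (s 2 0 + s 2 1) * hprod
    · change (-1 : Matrix (Fin 2) (Fin 2) ℂ).trace = s 3 0 + s 3 1
      rw [hs, hs, Matrix.trace_neg, Matrix.trace_one]
      norm_num
  · intro j
    fin_cases j
    · exact hAd
    · exact hBd
    · change ((-1 : ℂ) • ((s 2 0 * s 2 1) • (A * B).adjugate)).det = s 2 0 * s 2 1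
      rw [Matrix.det_smul, det_smul_adjugate hdet]
      simp
    · change (-1 : Matrix (Fin 2) (Fin 2) ℂ).det = s 3 0 * s 3 1
      simp [hs, Matrix.det_fin_two]
  · change A * B * ((-1 : ℂ) • ((s 2 0 * s 2 1) • (A * B).adjugate)) * -1 = 1
    rw [mul_smul_comm, mul_smul_adjugate hdet]
    simp

section chart

variable {s : Fin 4 → Fin 2 → ℂ} {a b : ℂ} {y : Fin 3 → ℂ} {M : Quadruple}

theorem scalarChartSecond_apply_ne_zero (hy : y ∈ scalarChartDom s a b) :
    scalarChartSecond s a b y 0 1 ≠ 0 := by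
  simpa [scalarChartSecond, solveTrace] using ⟨hy.2, hy.1.2⟩

theorem hasSpectra_scalarChartParam
    (hprod : s 0 0 * s 0 1 * (s 1 0 * s 1 1) * (s 2 0 * s 2 1) = 1) (hs : ∀ k, s 3 k = -1)
    (hadd : a + b = s 1 0 + s 1 1) (hmul : a * b = s 1 0 * s 1 1)
    (hy : y ∈ scalarChartDom s a b) : HasSpectra s (scalarChartParam s a b y) :=
  hasSpectra_of_pair hprod hs (trace_ofFirstRow _ _ _ _) (det_ofFirstRow _ _ _ hy.1.1.2)
    (trace_solveTrace.trans hadd) (det_solveTrace.trans hmul) (trace_mul_solveTrace hy.1.2)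

theorem scalarChartParam_mem_scalarChartSet (hy : y ∈ scalarChartDom s a b) :
    scalarChartParam s a b y ∈ scalarChartSet a b := by
  refine ⟨⟨hy.1.1.2, scalarChartSecond_apply_ne_zero hy⟩, ?_⟩
  change sandwich a b (scalarChartSecond s a b y) (scalarChartFirst s y) 0 1 ≠ 0
  rw [scalarChartSecond, sandwich_solveTrace]
  exact mul_ne_zero (pow_ne_zero _ (scalarChartSecond_apply_ne_zero hy)) hy.1.2

theorem mul_neg_of_mem_scalarLocus (hM : M ∈ scalarLocus s) : M 0 * M 1 * -M 2 = 1 := by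
  have := hM.1.prod
  rw [hM.2] at this
  simpa using this

theorem trace_of_mem_scalarLocus (hM : M ∈ scalarLocus s) :
    (M 0 * M 1).trace = scalarChartTrace s := by
  rw [trace_eq_of_mul_eq_one (mul_neg_of_mem_scalarLocus hM), scalarChartTrace, Matrix.det_mul,
    hM.1.det, hM.1.det, Matrix.trace_neg, hM.1.trace]

theorem slopeDet_ne_zero_of_mem_scalarChartSet (hM : HasSpectra s M)
    (hadd : a + b = s 1 0 + s 1 1) (h : M ∈ scalarChartSet a b) :
    slopeDet (M 0) ((M 1 1 1 - a) / M 1 0 1) ≠ 0 := by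
  have := h.2
  rw [sandwich_apply ((hM.trace 1).trans hadd.symm) h.1.2] at this
  exact right_ne_zero_of_mul this

theorem scalarChartFirst_scalarChartCoord (hM : HasSpectra s M) (h : M ∈ scalarChartSet a b) :
    scalarChartFirst s (scalarChartCoord a M) = M 0 := by
  rw [scalarChartFirst, ← hM.trace, ← hM.det]
  exact ofFirstRow_eq h.1.1

theorem scalarChartCoord_mem_scalarChartDom (hM : M ∈ scalarLocus s)
    (hadd : a + b = s 1 0 + s 1 1) (hmul : a * b = s 1 0 * s 1 1) (h : M ∈ scalarChartSet a b) :
    scalarChartCoord a M ∈ scalarChartDom s a b := by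
  refine ⟨⟨⟨trivial, h.1.1⟩, ?_⟩, ?_⟩
  · rw [scalarChartFirst_scalarChartCoord hM.1 h]
    exact slopeDet_ne_zero_of_mem_scalarChartSet hM.1 hadd h
  · rw [scalarChartFirst_scalarChartCoord hM.1 h, ← trace_of_mem_scalarLocus hM]
    change slopeNum _ _ _ _ ((M 1 1 1 - a) / M 1 0 1) ≠ 0
    rw [slopeNum_eq ((hM.1.trace 1).trans hadd.symm) ((hM.1.det 1).trans hmul.symm) h.1.2]
    exact mul_ne_zero h.1.2 (slopeDet_ne_zero_of_mem_scalarChartSet hM.1 hadd h)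

theorem scalarChartParam_scalarChartCoord (hM : M ∈ scalarLocus s)
    (hadd : a + b = s 1 0 + s 1 1) (hmul : a * b = s 1 0 * s 1 1) (h : M ∈ scalarChartSet a b) :
    scalarChartParam s a b (scalarChartCoord a M) = M := by
  have h1 : scalarChartSecond s a b (scalarChartCoord a M) = M 1 := by
    rw [scalarChartSecond, scalarChartFirst_scalarChartCoord hM.1 h, ← trace_of_mem_scalarLocus hM]
    exact solveTrace_eq ((hM.1.trace 1).trans hadd.symm) ((hM.1.det 1).trans hmul.symm) h.1.2
      (slopeDet_ne_zero_of_mem_scalarChartSet hM.1 hadd h)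
  funext j
  fin_cases j
  · exact scalarChartFirst_scalarChartCoord hM.1 h
  · exact h1
  · change (-1 : ℂ) • ((s 2 0 * s 2 1) • Matrix.adjugate _) = M 2
    rw [h1, scalarChartFirst_scalarChartCoord hM.1 h,
      smul_adjugate_eq (mul_neg_of_mem_scalarLocus hM) (by
        rw [Matrix.det_neg, hM.1.det]; simp)]
    simp
  · exact hM.2.symm

theorem scalarChartCoord_scalarChartParam (hy : y ∈ scalarChartDom s a b) :
    scalarChartCoord a (scalarChartParam s a b y) = y := by
  funext k
  fin_cases k
  · rfl
  · rfl
  · change (scalarChartSecond s a b y 1 1 - a) / scalarChartSecond s a b y 0 1 = y 2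
    rw [div_eq_iff (scalarChartSecond_apply_ne_zero hy)]
    simp [scalarChartSecond, solveTrace]

end chart

/-- The chart of `scalarLocus s` for an ordering `a`, `b` of the eigenvalues of the second
member. -/
noncomputable def scalarChart (s : Fin 4 → Fin 2 → ℂ) (a b : ℂ)
    (hprod : s 0 0 * s 0 1 * (s 1 0 * s 1 1) * (s 2 0 * s 2 1) = 1) (hs : ∀ k, s 3 k = -1)
    (hadd : a + b = s 1 0 + s 1 1) (hmul : a * b = s 1 0 * s 1 1) :
    Chart (coords '' scalarLocus s) 3 where
  dom := scalarChartDom s a b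
  nbhd := ofCoords ⁻¹' scalarChartSet a b
  param y := (scalarChartParam s a b y).coords
  coord z := scalarChartCoord a (ofCoords z)
  isOpen_dom := isOpen_scalarChartDom s a b
  isOpen_nbhd := isOpen_scalarChartSet a b
  regular_param := isRegularOn_coords fun j =>
    (isMatrixRegularOn_scalarChartParam s a b j).mono fun _ h => h.1
  regular_coord k := by
    have h := isMatrixRegularOn_ofCoords (coords '' scalarLocus s ∩ ofCoords ⁻¹' scalarChartSet a b)
    fin_cases k
    · exact h 0 0 0
    · exact h 0 0 1
    · exact ((h 1 1 1).sub (.const a)).div (h 1 0 1) fun _ hz => hz.2.1.2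
  mapsTo_param y hy := ⟨⟨_, ⟨hasSpectra_scalarChartParam hprod hs hadd hmul hy, rfl⟩, rfl⟩,
    scalarChartParam_mem_scalarChartSet hy⟩
  mapsTo_coord z hz :=
    scalarChartCoord_mem_scalarChartDom (mem_coords_image.1 hz.1) hadd hmul hz.2
  coord_param y hy := scalarChartCoord_scalarChartParam hy
  param_coord z hz := by
    rw [scalarChartParam_scalarChartCoord (mem_coords_image.1 hz.1) hadd hmul hz.2,
      coords_ofCoords]

/-- Generic unipotent conjugates lie in the chart. -/
theorem finite_conj_notMem_scalarChartSet {s : Fin 4 → Fin 2 → ℂ}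
    (hs : ∀ j, j ≠ 3 → s j 0 ≠ s j 1) {M : Quadruple} (hM : HasSpectra s M) {a b : ℂ}
    (hadd : a + b = s 1 0 + s 1 1) (hmul : a * b = s 1 0 * s 1 1)
    (h : sandwich a b (M 1) (M 0) ≠ 0) : {γ | M.conj γ ∉ scalarChartSet a b}.Finite := by
  have hj : ∀ j, j ≠ 3 → {γ | MatrixTwo.conj γ (M j) 0 1 = 0}.Finite := fun j hj =>
    finite_conj_apply_eq_zero (nonscalar_of_trace_det (hs j hj) (hM.trace j) (hM.det j))
  have h4 := finite_conj_apply_eq_zero (nonscalar_of_det_eq_zero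
    (det_sandwich ((hM.trace 1).trans hadd.symm) ((hM.det 1).trans hmul.symm)) h)
  refine (((hj 0 (by decide)).union (hj 1 (by decide))).union h4).subset fun γ hγ => ?_
  by_contra hγ'
  simp only [Set.mem_union, not_or] at hγ'
  refine hγ ⟨hγ'.1, ?_⟩
  have := hγ'.2
  rw [Set.mem_ofPred_eq, ← sandwich_conj] at this
  exact this

/-- A common eigenvector of `M 0` and `M 1` is also one of `M 2 = -(M 0 * M 1)⁻¹` and of `-1`. Hence
the conjugates of a single chart cover the scalar locus. -/
theorem sandwich_ne_zero_of_mem_scalarLocus {s : Fin 4 → Fin 2 → ℂ} (hgen : IsGeneric s)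
    (hs : s 1 0 ≠ s 1 1) {M : Quadruple} (hM : M ∈ scalarLocus s) :
    sandwich (s 1 0) (s 1 1) (M 1) (M 0) ≠ 0 := by
  intro h
  obtain ⟨v, hv, h1, μ, h0⟩ := exists_common_eigenvector hs (hM.1.trace 1) (hM.1.det 1) h
  refine hM.1.no_common_eigenvector hgen hv fun j => ?_
  fin_cases j
  · exact ⟨μ, h0⟩
  · exact ⟨_, h1⟩
  · have h2 : -M 2 * (M 0 * M 1) = 1 := mul_eq_one_comm.1 (mul_neg_of_mem_scalarLocus hM)
    refine ⟨-(s 1 1 * μ)⁻¹, ?_⟩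
    have := mulVec_eq_inv_smul h2 hv (μ := s 1 1 * μ) (by
      rw [← Matrix.mulVec_mulVec, h1, Matrix.mulVec_smul, h0, smul_smul])
    rw [Matrix.neg_mulVec, neg_eq_iff_eq_neg] at this
    rw [neg_smul]
    exact this
  · refine ⟨-1, ?_⟩
    change (M 3).mulVec v = _
    rw [hM.2]
    simp [Matrix.neg_mulVec]

theorem scalarLocus_nonempty {s : Fin 4 → Fin 2 → ℂ}
    (hprod : s 0 0 * s 0 1 * (s 1 0 * s 1 1) * (s 2 0 * s 2 1) = 1) (hs : ∀ k, s 3 k = -1)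
    (h0 : s 0 0 ≠ s 0 1) : (scalarLocus s).Nonempty := by
  have h0' := sub_ne_zero.2 h0
  -- With diagonal first member the trace of `A * B` is `s 0 0 * p + s 0 1 * (s 1 0 + s 1 1 - p)`,
  -- linear in `p`.
  set p := (scalarChartTrace s - s 0 1 * (s 1 0 + s 1 1)) / (s 0 0 - s 0 1) with hp
  have hp' : p * (s 0 0 - s 0 1) = scalarChartTrace s - s 0 1 * (s 1 0 + s 1 1) :=
    div_mul_cancel₀ _ h0'
  refine ⟨_, hasSpectra_of_pair hprod hs (A := !![s 0 0, 0; 0, s 0 1])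
    (B := ofFirstRow (s 1 0 + s 1 1) (s 1 0 * s 1 1) p 1) ?_ ?_ (trace_ofFirstRow _ _ _ _)
    (det_ofFirstRow _ _ _ one_ne_zero) ?_, rfl⟩
  · rw [Matrix.trace_fin_two_of]
  · rw [Matrix.det_fin_two_of, mul_zero, sub_zero]
  · simp [ofFirstRow, Matrix.trace_fin_two]
    linear_combination hp'

theorem isSmoothIrreducibleOfDim_scalarLocus {s : Fin 4 → Fin 2 → ℂ}
    (hprod : s 0 0 * s 0 1 * (s 1 0 * s 1 1) * (s 2 0 * s 2 1) * (s 3 0 * s 3 1) = 1)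
    (hgen : IsGeneric s) (hs : ∀ j, j ≠ 3 → s j 0 ≠ s j 1) (hs3 : ∀ k, s 3 k = -1) :
    IsSmoothIrreducibleOfDim (coords '' scalarLocus s) 3 := by
  have hprod' : s 0 0 * s 0 1 * (s 1 0 * s 1 1) * (s 2 0 * s 2 1) = 1 := by
    simpa [hs3] using hprod
  have hfin : ∀ M ∈ scalarLocus s, {γ | M.conj γ ∉ scalarChartSet (s 1 0) (s 1 1)}.Finite :=
    fun M hM => finite_conj_notMem_scalarChartSet hs hM.1 rfl rfl
      (sandwich_ne_zero_of_mem_scalarLocus hgen (hs 1 (by decide)) hM)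
  obtain ⟨M, hM⟩ := scalarLocus_nonempty hprod' hs3 (hs 0 (by decide))
  refine isSmoothIrreducibleOfDim_of_charts (isLocallyClosed_scalarLocus s) ?_
    (fun _ : Unit => scalarChart s _ _ hprod' hs3 rfl rfl) (fun M hM => ⟨(), hfin M hM⟩)
    ⟨M, hM, fun _ => hfin M hM⟩
  rintro γ M ⟨hM, h3⟩
  refine ⟨hM.conj γ, ?_⟩
  change MatrixTwo.conj γ (M 3) = -1
  rw [h3, ← neg_one_smul ℂ (1 : Matrix (Fin 2) (Fin 2) ℂ), conj_smul, conj_one]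

end Quadruple

namespace Quadruple

open MatrixTwo Variety

attribute [local instance] Variety.zariski

/-! ### Reversal of a quadruple -/

/-- The anti-automorphism `adjugate` applied to a quadruple in reversed (cyclic) order. -/
def rev (M : Quadruple) : Quadruple :=
  ![(M 2).adjugate, (M 1).adjugate, (M 0).adjugate, (M 3).adjugate]

/-- The spectra of the reversed quadruple. -/
def revSpectra (s : Fin 4 → Fin 2 → ℂ) : Fin 4 → Fin 2 → ℂ := ![s 2, s 1, s 0, s 3]

theorem rev_rev (M : Quadruple) : rev (rev M) = M := by
  funext j
  fin_cases j <;> exact adjugate_adjugate _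

theorem revSpectra_revSpectra (s : Fin 4 → Fin 2 → ℂ) : revSpectra (revSpectra s) = s := by
  funext j
  fin_cases j <;> rfl

theorem rev_conj (γ : ℂ) (M : Quadruple) : rev (conj γ M) = conj γ (rev M) := by
  funext j
  fin_cases j <;> exact adjugate_conj _ _

theorem adjugate_neg_one : (-1 : Matrix (Fin 2) (Fin 2) ℂ).adjugate = -1 := by
  rw [Matrix.adjugate_fin_two]
  ext i j
  fin_cases i <;> fin_cases j <;> simp

variable {s : Fin 4 → Fin 2 → ℂ} {M : Quadruple}

/-- The adjugate keeps trace and determinant and reverses products; the new product is the adjugate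
of the rotated relation `M 3 * M 0 * M 1 * M 2 = 1`. -/
theorem HasSpectra.rev (hM : HasSpectra s M) : HasSpectra (revSpectra s) (rev M) where
  trace j := by
    fin_cases j <;> exact (trace_adjugate _).trans (hM.trace _)
  det j := by
    fin_cases j <;> exact (det_adjugate _).trans (hM.det _)
  prod := by
    change (M 2).adjugate * (M 1).adjugate * (M 0).adjugate * (M 3).adjugate = 1
    rw [← Matrix.adjugate_mul_distrib, ← Matrix.adjugate_mul_distrib,
      ← Matrix.adjugate_mul_distrib, ← mul_assoc (M 0), mul_eq_one_comm.1 hM.prod,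
      Matrix.adjugate_one]

theorem rev_mem_nonscalarLocus (hM : M ∈ nonscalarLocus s) :
    rev M ∈ nonscalarLocus (revSpectra s) := by
  refine ⟨hM.1.rev, fun h => hM.2 ?_⟩
  change (M 3).adjugate = -1 at h
  rw [← adjugate_adjugate (M 3), h, adjugate_neg_one]

theorem isRegularOn_coords_rev (S : Set (Fin 4 × Fin 2 × Fin 2 → ℂ)) (i : Fin 4 × Fin 2 × Fin 2) :
    IsRegularOn S (fun z => (rev (ofCoords z)).coords i) := by
  refine isRegularOn_coords (F := fun z => rev (ofCoords z)) (fun j => ?_) i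
  have h := fun j => (isMatrixRegularOn_ofCoords S j).adjugate
  fin_cases j
  · exact h 2
  · exact h 1
  · exact h 0
  · exact h 3

/-- A chart of the reversed quadruples, as a chart of the original ones. -/
def revChart {d : ℕ} (c : Chart (coords '' nonscalarLocus (revSpectra s)) d) :
    Chart (coords '' nonscalarLocus s) d :=
  c.map (fun z => (rev (ofCoords z)).coords) (fun z => (rev (ofCoords z)).coords)
    (isRegularOn_coords_rev _) (isRegularOn_coords_rev _)
    (fun z hz => mem_coords_image.2 (by
      have := rev_mem_nonscalarLocus (mem_coords_image.1 hz)
      rwa [revSpectra_revSpectra] at this))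
    (fun z hz => mem_coords_image.2 (rev_mem_nonscalarLocus (mem_coords_image.1 hz)))
    (fun z _ => by rw [ofCoords_coords, rev_rev, coords_ofCoords])
    (fun z _ => by rw [ofCoords_coords, rev_rev, coords_ofCoords])

/-! ### The charts cover -/

theorem HasSpectra.commute_last (hM : HasSpectra s M)
    (h : M 2 * (M 0 * M 1) = M 0 * M 1 * M 2) : M 3 * M 2 = M 2 * M 3 := by
  have h' : M 3 * (M 0 * M 1 * M 2) = 1 := mul_eq_one_comm.1 hM.prod
  calc M 3 * M 2 = M 3 * (M 2 * (M 0 * M 1)) * M 2 * M 3 := by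
        rw [← mul_one (M 3 * M 2), ← hM.prod]
        simp only [mul_assoc]
    _ = M 2 * M 3 := by rw [h, h', one_mul]

/-- In `Fin 2` the index `e + 1` is the other one, so `h` covers both orderings of the eigenvalues.
-/
theorem HasSpectra.commute_of_sandwich_eq_zero (hs : s 2 0 ≠ s 2 1) (hM : HasSpectra s M)
    (h : ∀ e : Fin 2, sandwich (s 2 e) (s 2 (e + 1)) (M 2) (M 0 * M 1) = 0) :
    M 3 * M 2 = M 2 * M 3 :=
  hM.commute_last (MatrixTwo.commute_of_sandwich_eq_zero hs (h 0) (h 1))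

/-- Otherwise `M 2` and, by reversal, `M 0` commute with the nonscalar `M 3`, so both are linear
combinations of `1` and `M 3`. An eigenvector of `M 3` is then one of `M 0`, of `M 2` and of `M 1 =
(M 2 * M 3 * M 0)⁻¹`, against genericity. -/
theorem exists_sandwich_ne_zero (hgen : IsGeneric s) (hs : ∀ j, j ≠ 3 → s j 0 ≠ s j 1)
    (hM : HasSpectra s M) (h3 : M 3 0 1 ≠ 0 ∨ M 3 1 1 ≠ M 3 0 0 ∨ M 3 1 0 ≠ 0) :
    (∃ e : Fin 2, sandwich (s 2 e) (s 2 (e + 1)) (M 2) (M 0 * M 1) ≠ 0) ∨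
    ∃ e : Fin 2, sandwich (s 0 e) (s 0 (e + 1)) (rev M 2) (rev M 0 * rev M 1) ≠ 0 := by
  by_contra! h
  have h2 := hM.commute_of_sandwich_eq_zero (hs 2 (by decide)) h.1
  have h0 : (M 3).adjugate * (M 0).adjugate = (M 0).adjugate * (M 3).adjugate :=
    hM.rev.commute_of_sandwich_eq_zero (hs 0 (by decide)) h.2
  rw [← Matrix.adjugate_mul_distrib, ← Matrix.adjugate_mul_distrib] at h0
  replace h0 : M 0 * M 3 = M 3 * M 0 := by
    rw [← adjugate_adjugate (M 0 * M 3), h0, adjugate_adjugate]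
  obtain ⟨α, β, h2⟩ := exists_eq_add_of_commute h2 h3
  obtain ⟨α', β', h0⟩ := exists_eq_add_of_commute h0.symm h3
  obtain ⟨v, hv, hv3⟩ := exists_eigenvector (hM.trace 3) (hM.det 3)
  have hv2 : (M 2).mulVec v = (α + β * s 3 0) • v := by
    rw [h2, Matrix.add_mulVec, Matrix.smul_mulVec, Matrix.smul_mulVec, Matrix.one_mulVec, hv3,
      smul_smul, add_smul]
  have hv0 : (M 0).mulVec v = (α' + β' * s 3 0) • v := by
    rw [h0, Matrix.add_mulVec, Matrix.smul_mulVec, Matrix.smul_mulVec, Matrix.one_mulVec, hv3,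
      smul_smul, add_smul]
  have hprod : M 1 * (M 2 * M 3 * M 0) = 1 := by
    have := hM.prod
    rw [mul_assoc, mul_assoc, mul_eq_one_comm] at this
    rw [← this]
    simp only [mul_assoc]
  refine hM.no_common_eigenvector hgen hv fun j => ?_
  fin_cases j
  · exact ⟨_, hv0⟩
  · refine ⟨_, mulVec_eq_inv_smul hprod hv
      (μ := (α' + β' * s 3 0) * (s 3 0 * (α + β * s 3 0))) ?_⟩
    rw [← Matrix.mulVec_mulVec, ← Matrix.mulVec_mulVec, hv0, Matrix.mulVec_smul, hv3,
      Matrix.mulVec_smul, Matrix.mulVec_smul, hv2, smul_smul, smul_smul]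
    congr 1
    ring
  · exact ⟨_, hv2⟩
  · exact ⟨_, hv3⟩

/-! ### The charts meet -/

/-- The matrices have no common eigenvector. -/
def NoCommonEigenvector (X Y : Matrix (Fin 2) (Fin 2) ℂ) : Prop :=
  ∀ (v : Fin 2 → ℂ) (c d : ℂ), X.mulVec v = c • v → Y.mulVec v = d • v → v = 0

/-- The eigenlines of the diagonal matrix are the coordinate axes, and the off-diagonal entries of
`X` move both. -/
theorem noCommonEigenvector_diagonal {X : Matrix (Fin 2) (Fin 2) ℂ} {a b : ℂ} (hab : a ≠ b)
    (h01 : X 0 1 ≠ 0) (h10 : X 1 0 ≠ 0) : NoCommonEigenvector X !![a, 0; 0, b] := by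
  intro v c d hX hY
  have x0 := congrFun hX 0
  have x1 := congrFun hX 1
  have y0 := congrFun hY 0
  have y1 := congrFun hY 1
  simp only [Matrix.mulVec, dotProduct, Fin.sum_univ_two, Pi.smul_apply, smul_eq_mul,
    Matrix.of_apply, Matrix.cons_val] at x0 x1 y0 y1
  have h : v 0 * v 1 = 0 := by
    refine (mul_eq_zero.1 (?_ : (a - b) * (v 0 * v 1) = 0)).resolve_left (sub_ne_zero.2 hab)
    linear_combination v 1 * y0 - v 0 * y1
  rcases mul_eq_zero.1 h with h | h
  · have h' : v 1 = 0 := by simpa [h, h01] using x0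
    ext i
    fin_cases i <;> assumption
  · have h' : v 0 = 0 := by simpa [h, h10] using x1
    ext i
    fin_cases i <;> assumption

/-- The only eigenline of the block is the first axis, which `X` moves. -/
theorem noCommonEigenvector_jordan {X : Matrix (Fin 2) (Fin 2) ℂ} {a b : ℂ} (hb : b ≠ 0)
    (h10 : X 1 0 ≠ 0) : NoCommonEigenvector X !![a, b; 0, a] := by
  intro v c d hX hY
  have x1 := congrFun hX 1
  have y0 := congrFun hY 0
  have y1 := congrFun hY 1
  simp only [Matrix.mulVec, dotProduct, Fin.sum_univ_two, Pi.smul_apply, smul_eq_mul,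
    Matrix.of_apply, Matrix.cons_val] at x1 y0 y1
  have h : v 1 = 0 := by
    have : b * v 1 ^ 2 = 0 := by linear_combination v 1 * y0 - v 0 * y1
    simpa [hb] using this
  have h' : v 0 = 0 := by simpa [h, h10] using x1
  ext i
  fin_cases i <;> assumption

/-- A common eigenvector of `M 2` and `M 0 * M 1` is one of `M 3`, the inverse of `M 0 * M 1 * M 2`.
Since `h` does not mention `a` and `b`, one quadruple serves both orderings. -/
theorem HasSpectra.sandwich_ne_zero (hM : HasSpectra s M) (h : NoCommonEigenvector (M 2) (M 3))
    {a b : ℂ} (hab : a ≠ b) (hadd : a + b = s 2 0 + s 2 1) (hmul : a * b = s 2 0 * s 2 1) :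
    sandwich a b (M 2) (M 0 * M 1) ≠ 0 := by
  intro h0
  obtain ⟨v, hv, h2, μ, hμ⟩ := exists_common_eigenvector hab ((hM.trace 2).trans hadd.symm)
    ((hM.det 2).trans hmul.symm) h0
  refine hv (h v _ _ h2 (mulVec_eq_inv_smul (mul_eq_one_comm.1 hM.prod) hv (μ := b * μ) ?_))
  rw [← Matrix.mulVec_mulVec, h2, Matrix.mulVec_smul, hμ, smul_smul]

/-- The nonscalar locus is smooth and irreducible if its last members are not scalar and there is
a quadruple in which the last member has no common eigenvector with its neighbours. -/
theorem isSmoothIrreducibleOfDim_nonscalarLocus (hgen : IsGeneric s)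
    (hs : ∀ j, j ≠ 3 → s j 0 ≠ s j 1)
    (h3 : ∀ M ∈ nonscalarLocus s, M 3 0 1 ≠ 0 ∨ M 3 1 1 ≠ M 3 0 0 ∨ M 3 1 0 ≠ 0)
    (hN : ∃ N ∈ nonscalarLocus s, NoCommonEigenvector (N 2) (N 3) ∧
      NoCommonEigenvector (N 0).adjugate (N 3).adjugate) :
    IsSmoothIrreducibleOfDim (coords '' nonscalarLocus s) 5 := by
  obtain ⟨N, hN, hN2, hN0⟩ := hN
  have hprod := hN.1.prod_eq_one
  have hprod' := hN.1.rev.prod_eq_one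
  have hadd : ∀ j (e : Fin 2), s j e + s j (e + 1) = s j 0 + s j 1 := fun j e => by
    fin_cases e
    · rfl
    · exact add_comm _ _
  have hmul : ∀ j (e : Fin 2), s j e * s j (e + 1) = s j 0 * s j 1 := fun j e => by
    fin_cases e
    · rfl
    · exact mul_comm _ _
  have hne : ∀ j (e : Fin 2), j ≠ 3 → s j e ≠ s j (e + 1) := fun j e hj => by
    fin_cases e
    · exact hs j hj
    · exact (hs j hj).symm
  have hs' : ∀ j, j ≠ 3 → revSpectra s j 0 ≠ revSpectra s j 1 := fun j hj => by
    fin_cases j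
    · exact hs 2 (by decide)
    · exact hs 1 (by decide)
    · exact hs 0 (by decide)
    · exact absurd rfl hj
  -- Four charts: one for each ordering of the eigenvalues of `M 2`, and one for each ordering of
  -- those of `M 0` through reversal.
  let c : Fin 2 ⊕ Fin 2 → Chart (coords '' nonscalarLocus s) 5 := Sum.elim
    (fun e => nonscalarChart s _ _ hprod (hadd 2 e) (hmul 2 e))
    (fun e => revChart (nonscalarChart (revSpectra s) _ _ hprod' (hadd 0 e) (hmul 0 e)))
  have hfin : ∀ M : Quadruple, HasSpectra s M → ∀ e : Fin 2,
      sandwich (s 2 e) (s 2 (e + 1)) (M 2) (M 0 * M 1) ≠ 0 →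
      {γ | (M.conj γ).coords ∉ (c (Sum.inl e)).nbhd}.Finite := fun M hM e h =>
    finite_conj_notMem_chartSet hs hM (hadd 2 e) (hmul 2 e) h
  have hfin' : ∀ M : Quadruple, HasSpectra s M → ∀ e : Fin 2,
      sandwich (s 0 e) (s 0 (e + 1)) (rev M 2) (rev M 0 * rev M 1) ≠ 0 →
      {γ | (M.conj γ).coords ∉ (c (Sum.inr e)).nbhd}.Finite := fun M hM e h => by
    have := finite_conj_notMem_chartSet hs' hM.rev (hadd 0 e) (hmul 0 e) h
    simp only [← rev_conj] at this
    exact this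
  refine isSmoothIrreducibleOfDim_of_charts (isLocallyClosed_nonscalarLocus s) ?_ c ?_
    ⟨N, hN, ?_⟩
  · rintro γ M ⟨hM, h⟩
    refine ⟨hM.conj γ, fun h' => h ?_⟩
    have := congrFun (conj_zero M) 3
    rw [← neg_add_cancel γ, ← conj_conj] at this
    change MatrixTwo.conj (-γ) (conj γ M 3) = M 3 at this
    rw [← this, h', ← neg_one_smul ℂ (1 : Matrix (Fin 2) (Fin 2) ℂ), conj_smul, conj_one]
  · intro M hM
    rcases exists_sandwich_ne_zero hgen hs hM.1 (h3 M hM) with ⟨e, he⟩ | ⟨e, he⟩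
    · exact ⟨_, hfin M hM.1 e he⟩
    · exact ⟨_, hfin' M hM.1 e he⟩
  · rintro (e | e)
    · exact hfin N hN.1 e (hN.1.sandwich_ne_zero hN2 (hne 2 e (by decide)) (hadd 2 e) (hmul 2 e))
    · exact hfin' N hN.1 e
        (hN.1.rev.sandwich_ne_zero hN0 (hne 0 e (by decide)) (hadd 0 e) (hmul 0 e))

/-- The second member can be recovered from the others. -/
theorem hasSpectra_of_triple
    (hprod : s 0 0 * s 0 1 * (s 1 0 * s 1 1) * (s 2 0 * s 2 1) * (s 3 0 * s 3 1) = 1)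
    {A B C : Matrix (Fin 2) (Fin 2) ℂ} (hAt : A.trace = s 0 0 + s 0 1)
    (hAd : A.det = s 0 0 * s 0 1) (hBt : B.trace = s 2 0 + s 2 1) (hBd : B.det = s 2 0 * s 2 1)
    (hCt : C.trace = s 3 0 + s 3 1) (hCd : C.det = s 3 0 * s 3 1)
    (htr : (B * C * A).trace =
      (s 1 0 + s 1 1) * (s 0 0 * s 0 1 * (s 2 0 * s 2 1) * (s 3 0 * s 3 1))) :
    HasSpectra s ![A, (s 1 0 * s 1 1) • (B * C * A).adjugate, B, C] := by
  have hdet : (B * C * A).det * (s 1 0 * s 1 1) = 1 := by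
    rw [Matrix.det_mul, Matrix.det_mul, hAd, hBd, hCd, ← hprod]
    ring
  refine ⟨?_, ?_, ?_⟩
  · intro j
    fin_cases j
    · exact hAt
    · change ((s 1 0 * s 1 1) • (B * C * A).adjugate).trace = s 1 0 + s 1 1
      rw [Matrix.trace_smul, trace_adjugate, htr, smul_eq_mul]
      linear_combination (s 1 0 + s 1 1) * hprod
    · exact hBt
    · exact hCt
  · intro j
    fin_cases j
    · exact hAd
    · exact det_smul_adjugate hdet
    · exact hBd
    · exact hCd
  · change A * ((s 1 0 * s 1 1) • (B * C * A).adjugate) * B * C = 1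
    have := mul_smul_adjugate hdet
    rw [mul_assoc, mul_eq_one_comm] at this
    rw [mul_assoc _ B]
    exact this

theorem exists_quadratic_root {a : ℂ} (b c : ℂ) (ha : a ≠ 0) : ∃ x, a * (x * x) + b * x + c = 0 :=
  exists_quadratic_eq_zero ha (IsAlgClosed.exists_eq_mul_self _)

theorem exists_noCommonEigenvector_diagonal
    (hprod : s 0 0 * s 0 1 * (s 1 0 * s 1 1) * (s 2 0 * s 2 1) * (s 3 0 * s 3 1) = 1)
    (hs : s 3 0 ≠ s 3 1) : ∃ N ∈ nonscalarLocus s, NoCommonEigenvector (N 2) (N 3) ∧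
      NoCommonEigenvector (N 0).adjugate (N 3).adjugate := by
  -- The expression is `-(p - s j 0) * (p - s j 1)`, so any `p` that is not an eigenvalue works; it
  -- makes the lower left entry nonzero.
  have hroot : ∀ j, ∃ p, p * (s j 0 + s j 1 - p) - s j 0 * s j 1 ≠ 0 := fun j => by
    obtain ⟨p, hp⟩ := Infinite.exists_notMem_finset ({s j 0, s j 1} : Finset ℂ)
    simp only [Finset.mem_insert, Finset.mem_singleton, not_or] at hp
    refine ⟨p, fun h => mul_ne_zero (sub_ne_zero.2 hp.1) (sub_ne_zero.2 hp.2) ?_⟩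
    linear_combination -h
  obtain ⟨p, hp⟩ := hroot 0
  obtain ⟨q, hq⟩ := hroot 2
  have hs3 : s 3 0 * s 3 1 ≠ 0 := right_ne_zero_of_mul (hprod.symm ▸ one_ne_zero)
  -- With first rows `(p, κ)` and `(q, 1)` and diagonal last member, the trace condition on the
  -- second member, multiplied by `κ`, is this quadratic. The choice of `p` makes its constant term
  -- nonzero, whence `κ ≠ 0`.
  obtain ⟨κ, hκ⟩ := exists_quadratic_root
    (s 3 0 * q * p + s 3 1 * (s 2 0 + s 2 1 - q) * (s 0 0 + s 0 1 - p) -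
      (s 1 0 + s 1 1) * (s 0 0 * s 0 1 * (s 2 0 * s 2 1) * (s 3 0 * s 3 1)))
    (s 3 1 * (p * (s 0 0 + s 0 1 - p) - s 0 0 * s 0 1))
    (mul_ne_zero (left_ne_zero_of_mul hs3) hq)
  have hκ0 : κ ≠ 0 := by
    rintro rfl
    refine mul_ne_zero (right_ne_zero_of_mul hs3) hp ?_
    linear_combination hκ
  refine ⟨_, ⟨hasSpectra_of_triple hprod (trace_ofFirstRow _ _ p κ) (det_ofFirstRow _ _ _ hκ0)
    (trace_ofFirstRow _ _ q 1) (det_ofFirstRow _ _ _ one_ne_zero)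
    (Matrix.trace_fin_two_of (s 3 0) 0 0 (s 3 1))
    ((Matrix.det_fin_two_of (s 3 0) 0 0 (s 3 1)).trans (by ring)) ?_, fun h => ?_⟩, ?_, ?_⟩
  · simp only [ofFirstRow, Matrix.trace_fin_two, Matrix.mul_apply, Fin.sum_univ_two,
      Matrix.of_apply, Matrix.cons_val]
    field_simp
    linear_combination hκ
  · change (!![s 3 0, 0; 0, s 3 1] : Matrix (Fin 2) (Fin 2) ℂ) = -1 at h
    have h0 := congrFun (congrFun h 0) 0
    have h1 := congrFun (congrFun h 1) 1
    exact hs (h0.trans h1.symm)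
  · refine noCommonEigenvector_diagonal hs ?_ ?_
    · simp [ofFirstRow]
    · simpa [ofFirstRow] using hq
  · change NoCommonEigenvector (Matrix.adjugate (ofFirstRow _ _ _ _)) (Matrix.adjugate !![_, _; _, _])
    rw [ofFirstRow, Matrix.adjugate_fin_two_of, Matrix.adjugate_fin_two_of, neg_zero]
    refine noCommonEigenvector_diagonal hs.symm ?_ ?_
    · simpa using hκ0
    · simpa [hκ0] using hp

theorem exists_noCommonEigenvector_jordan
    (hprod : s 0 0 * s 0 1 * (s 1 0 * s 1 1) * (s 2 0 * s 2 1) * (s 3 0 * s 3 1) = 1)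
    (hs : ∀ k, s 3 k = -1) : ∃ N ∈ nonscalarLocus s, NoCommonEigenvector (N 2) (N 3) ∧
      NoCommonEigenvector (N 0).adjugate (N 3).adjugate := by
  -- The lower left entries of the first and third members are fixed as `1`, which excludes common
  -- eigenvectors with the Jordan block. The trace condition is then a monic quadratic in the lower
  -- right entry `w` of the first.
  obtain ⟨w, hw⟩ := exists_quadratic_root (-(s 0 0 + s 0 1 + (s 2 0 + s 2 1) - 1))
    (s 0 0 * s 0 1 + s 2 0 * s 2 1 -
      (s 1 0 + s 1 1) * (s 0 0 * s 0 1 * (s 2 0 * s 2 1) * (s 3 0 * s 3 1))) (one_ne_zero (α := ℂ))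
  refine ⟨_, ⟨hasSpectra_of_triple hprod
    (A := !![s 0 0 + s 0 1 - w, w * (s 0 0 + s 0 1 - w) - s 0 0 * s 0 1; 1, w])
    (B := !![0, -(s 2 0 * s 2 1); 1, s 2 0 + s 2 1]) (C := !![-1, 1; 0, -1])
    ?_ ?_ ?_ ?_ ?_ ?_ ?_, fun h => ?_⟩, ?_, ?_⟩
  · rw [Matrix.trace_fin_two_of]; ring
  · rw [Matrix.det_fin_two_of]; ring
  · rw [Matrix.trace_fin_two_of]; ring
  · rw [Matrix.det_fin_two_of]; ring
  · rw [Matrix.trace_fin_two_of, hs, hs]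
  · rw [Matrix.det_fin_two_of, hs, hs]; ring
  · simp only [Matrix.trace_fin_two, Matrix.mul_apply, Fin.sum_univ_two,
      Matrix.of_apply, Matrix.cons_val]
    linear_combination hw
  · change (!![-1, 1; 0, -1] : Matrix (Fin 2) (Fin 2) ℂ) = -1 at h
    have h0 := congrFun (congrFun h 0) 1
    simp at h0
  · exact noCommonEigenvector_jordan one_ne_zero (by simp)
  · change NoCommonEigenvector (Matrix.adjugate !![_, _; _, _]) (Matrix.adjugate !![_, _; _, _])
    rw [Matrix.adjugate_fin_two_of, Matrix.adjugate_fin_two_of, neg_zero]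
    exact noCommonEigenvector_jordan (by simp) (by simp)

/-! ### The three sets of quadruples -/

theorem hasSpectra_iff (hs : ∀ j, s j 0 ≠ s j 1) :
    HasSpectra s M ↔ M ∈ quadruples (diagRep s) := by
  simp only [quadruples, diagRep, Set.mem_ofPred_eq, isConj_diagonal_iff (hs _)]
  exact ⟨fun h => ⟨fun j => ⟨h.trace j, h.det j⟩, h.prod⟩,
    fun h => ⟨fun j => (h.1 j).1, fun j => (h.1 j).2, h.2⟩⟩

/-- The matrix `-1` is excluded automatically, because its eigenvalues coincide. -/
theorem quadruples_diagRep_eq (hs : ∀ j, s j 0 ≠ s j 1) :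
    quadruples (diagRep s) = nonscalarLocus s := by
  ext M
  rw [← hasSpectra_iff hs]
  refine ⟨fun h => ⟨h, fun h3 => hs 3 ?_⟩, fun h => h.1⟩
  have ht := h.trace 3
  have hd := h.det 3
  rw [h3, Matrix.trace_fin_two] at ht
  rw [h3, Matrix.det_fin_two] at hd
  simp at ht hd
  have : (s 3 0 - s 3 1) ^ 2 = 0 := by
    linear_combination -(s 3 0 + s 3 1 + (-1 + -1)) * ht + 4 * hd
  exact sub_eq_zero.1 ((pow_eq_zero_iff two_ne_zero).1 this)

theorem quadruples_diagRep_eq_scalarLocus (hs : ∀ j, j ≠ 3 → s j 0 ≠ s j 1)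
    (hs3 : ∀ k, s 3 k = -1) : quadruples (diagRep s) = scalarLocus s := by
  have hdiag : diagRep s 3 = -1 := by
    ext i j
    fin_cases i <;> fin_cases j <;> simp [diagRep, hs3]
  ext M
  constructor
  · rintro ⟨h, hp⟩
    have h3 : M 3 = -1 := by
      have := (h 3).symm
      rw [hdiag] at this
      exact isConj_neg_one_iff.1 this
    have hj : ∀ j, (M j).trace = s j 0 + s j 1 ∧ (M j).det = s j 0 * s j 1 := fun j => by
      by_cases hj : j = 3
      · subst hj
        rw [h3, hs3, hs3, Matrix.det_neg, Matrix.trace_neg, Matrix.trace_one]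
        norm_num
      · exact (isConj_diagonal_iff (hs j hj)).1 (h j)
    exact ⟨⟨fun j => (hj j).1, fun j => (hj j).2, hp⟩, h3⟩
  · rintro ⟨h, h3⟩
    refine ⟨fun j => ?_, h.prod⟩
    by_cases hj : j = 3
    · subst hj
      rw [hdiag, h3]
    · exact (isConj_diagonal_iff (hs j hj)).2 ⟨h.trace j, h.det j⟩

/-- Among the matrices with double eigenvalue `-1`, the Jordan class is the complement of `-1`. -/
theorem quadruples_jordanRep_eq (hs : ∀ j, j ≠ 3 → s j 0 ≠ s j 1) (hs3 : ∀ k, s 3 k = -1) :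
    quadruples (jordanRep s) = nonscalarLocus s := by
  have hneg : (-1 + -1 : ℂ) = -2 := by norm_num
  have hone : (-1 * -1 : ℂ) = 1 := by norm_num
  ext M
  constructor
  · rintro ⟨h, hp⟩
    have h3 := isConj_jordan_iff.1 (by simpa [jordanRep] using h 3 : IsConj _ (M 3))
    have hj : ∀ j, (M j).trace = s j 0 + s j 1 ∧ (M j).det = s j 0 * s j 1 := fun j => by
      by_cases hj : j = 3
      · subst hj
        rw [hs3, hs3, hneg, hone]
        exact ⟨h3.1, h3.2.1⟩
      · exact (isConj_diagonal_iff (hs j hj)).1 (by simpa [jordanRep, hj] using h j)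
    exact ⟨⟨fun j => (hj j).1, fun j => (hj j).2, hp⟩, h3.2.2⟩
  · rintro ⟨h, h3⟩
    refine ⟨fun j => ?_, h.prod⟩
    by_cases hj : j = 3
    · subst hj
      have ht := h.trace 3
      have hd := h.det 3
      rw [hs3, hs3, hneg] at ht
      rw [hs3, hs3, hone] at hd
      simpa [jordanRep] using isConj_jordan_iff.2 ⟨ht, hd, h3⟩
    · simpa [jordanRep, hj] using (isConj_diagonal_iff (hs j hj)).2 ⟨h.trace j, h.det j⟩

/-- A matrix with double eigenvalue `-1` that is not `-1` is not scalar. -/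
theorem last_nonscalar_of_eq_neg_one (hs3 : ∀ k, s 3 k = -1) (hM : M ∈ nonscalarLocus s) :
    M 3 0 1 ≠ 0 ∨ M 3 1 1 ≠ M 3 0 0 ∨ M 3 1 0 ≠ 0 := by
  by_contra! h
  obtain ⟨h1, h2, h3⟩ := h
  have ht := hM.1.trace 3
  rw [Matrix.trace_fin_two, h2, hs3, hs3] at ht
  have h0 : M 3 0 0 = -1 := by linear_combination ht / 2
  refine hM.2 ?_
  ext i j
  fin_cases i <;> fin_cases j <;> simp [h0, h1, h2, h3]

end Quadruple

/-! ### The theorem -/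

theorem mainTheorem11 (s : Fin 4 → Fin 2 → ℂ)
    (hprod : ∏ j, ∏ k, s j k = 1) (hgen : IsGeneric s) :
    -- part 1: the fourth matrix has the single eigenvalue `-1`
    ((∀ j, j ≠ 3 → s j 0 ≠ s j 1) → (∀ k, s 3 k = -1) →
      -- the fourth matrix is scalar, equal to `-I`
      (Variety.IsSmoothIrreducibleOfDim (Quadruple.coords '' quadruples (diagRep s)) 3 ∧
        ∀ M ∈ quadruples (diagRep s), M.IsIrreducible) ∧
      -- the fourth matrix is conjugate to a Jordan block of size 2
      (Variety.IsSmoothIrreducibleOfDim (Quadruple.coords '' quadruples (jordanRep s)) 5 ∧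
        ∀ M ∈ quadruples (jordanRep s), M.IsIrreducible)) ∧
    -- part 2: all four matrices are diagonalizable with two distinct eigenvalues
    ((∀ j, s j 0 ≠ s j 1) →
      Variety.IsSmoothIrreducibleOfDim (Quadruple.coords '' quadruples (diagRep s)) 5) := by
  have hprod' : s 0 0 * s 0 1 * (s 1 0 * s 1 1) * (s 2 0 * s 2 1) * (s 3 0 * s 3 1) = 1 := by
    simpa [Fin.prod_univ_four, Fin.prod_univ_two] using hprod
  refine ⟨fun hs hs3 => ?_, fun hs => ?_⟩
  · rw [Quadruple.quadruples_diagRep_eq_scalarLocus hs hs3, Quadruple.quadruples_jordanRep_eq hs hs3]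
    exact ⟨⟨Quadruple.isSmoothIrreducibleOfDim_scalarLocus hprod' hgen hs hs3,
      fun M hM => hM.1.isIrreducible hgen⟩,
      Quadruple.isSmoothIrreducibleOfDim_nonscalarLocus hgen hs
        (fun M hM => Quadruple.last_nonscalar_of_eq_neg_one hs3 hM)
        (Quadruple.exists_noCommonEigenvector_jordan hprod' hs3),
      fun M hM => hM.1.isIrreducible hgen⟩
  · rw [Quadruple.quadruples_diagRep_eq hs]
    exact Quadruple.isSmoothIrreducibleOfDim_nonscalarLocus hgen (fun j _ => hs j)
      (fun M hM => MatrixTwo.nonscalar_of_trace_det (hs 3) (hM.1.trace 3) (hM.1.det 3))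
      (Quadruple.exists_noCommonEigenvector_diagonal hprod' (hs 3))
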